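/- Write $\partial=\tfrac12(\partial_x-i\partial_y)$ and $\bar\partial=\tfrac12(\partial_x+i\partial_y)$ on $\mathbb C$. Let $u:\mathbb C\to\mathbb R$ be a smooth solution of the sinh-Gordon equation $\partial\bar\partial u+\tfrac12\sinh(2u)=0$ with two $\mathbb R$-linearly independent periods $\gamma_1,\gamma_2$. Let $\mathbb T=\mathbb C/(\mathbb Z\gamma_1+\mathbb Z\gamma_2)$ and $\langle f\rangle=\frac1{\mathrm{area}(\mathbb T)}\int_{\mathbb T}f\,dS$. For $\lambda\in\mathbb C^*$ consider the linear system $$\partial\psi=\tfrac12\begin{pmatrix}\partial u& i e^{-u}\\ i\lambda^{-1}e^{u}&-\partial u\end{pmatrix}\psi,\qquad \bar\partial\psi=\tfrac12\begin{pmatrix}-\bar\partial u& i\lambda e^{u}\\ i e^{-u}&\bar\partial u\end{pmatrix}\psi ,$$ and let the (affine) spectral curve $\Sigma$ be the set of all $(\lambda,\mu_1,\mu_2)$ with $\lambda\in\mathbb C^*$ for which this system has a solution $\psi\not\equiv0$ with $\psi(z+\gamma_k)=\mu_k\psi(z)$ for all $z$ and $k=1,2$. Differentials on $\Sigma$ are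 understood on its normalization. Then there is exactly one pair of holomorphic differentials $dp^+,dp^-$ on $\Sigma$ with $$d\ln\mu_k=\gamma_k\,dp^++\bar\gamma_k\,dp^-,\qquad k=1,2 .$$ Over a punctured disc around $\lambda=0$ (respectively $\lambda=\infty$) the curve $\Sigma$ is a punctured disc with coordinate a square root $\lambda^{1/2}$ (respectively $\lambda^{-1/2}$) of $\lambda$ (respectively $\lambda^{-1}$), so that a single point is added there. The differential $dp^-$ extends holomorphically to $\lambda=0$ and $dp^+$ extends holomorphically to $\lambda=\infty$. For a suitable choice of the signs of these square roots, \begin{align*} dp^+&=d\lambda^{1/2}\left(-\tfrac i2\lambda^{-1}-i\langle(\partial u)^2\rangle+O(\lambda)\right)&&\text{at }\lambda=0,\\ dp^-&=d\lambda^{1/2}\left(\tfrac i2\langle\cosh(2u)\rangle+O(\lambda)\right)&&\text{at }\lambda=0,\\ dp^+&=d\lambda^{-1/2}\left(\tfrac i2\langle\cosh(2u)\rangle+O(\lambda^{-1})\right)&&\text{at }\lambda=\infty,\\ dp^-&=d\lambda^{-1/2}\left(-\tfrac i2\lambda-i\langle(\bar\partial u)^2\rangle+O(\lambda^{-1})\right)&&\text{at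 }\lambda=\infty. \end{align*} -/

import Mathlib

open scoped ContDiff Topology ComplexConjugate
open Asymptotics

noncomputable section

namespace SinhGordon

/-- The Wirtinger derivative `∂f = (f_x - i f_y)/2`. -/
def del (f : ℂ → ℂ) (z : ℂ) : ℂ :=
  (1 / 2) * (fderiv ℝ f z 1 - Complex.I * fderiv ℝ f z Complex.I)

/-- The Wirtinger derivative `∂̄f = (f_x + i f_y)/2`. -/
def delbar (f : ℂ → ℂ) (z : ℂ) : ℂ :=
  (1 / 2) * (fderiv ℝ f z 1 + Complex.I * fderiv ℝ f z Complex.I)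

/-- A real-valued function on the plane, regarded as complex-valued. -/
def cplx (u : ℂ → ℝ) : ℂ → ℂ := fun z => (u z : ℂ)

/-- `u` is a smooth solution of the sinh-Gordon equation `∂∂̄u + (1/2) sinh(2u) = 0`. -/
def IsSolution (u : ℂ → ℝ) : Prop :=
  ContDiff ℝ ∞ u ∧
    ∀ z, del (delbar (cplx u)) z + (1 / 2) * (Real.sinh (2 * u z) : ℂ) = 0

/-- `γ 0, γ 1` form a basis of a lattice in `ℂ` all of whose elements are periods of `u`. -/
def IsDoublyPeriodic (u : ℂ → ℝ) (γ : Fin 2 → ℂ) : Prop :=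
  LinearIndependent ℝ γ ∧ ∀ k z, u (z + γ k) = u z

/-- The half-open period parallelogram spanned by `γ 0, γ 1`, a fundamental domain of the
torus `ℂ / (ℤ γ 0 + ℤ γ 1)`. -/
def parallelogram (γ : Fin 2 → ℂ) : Set ℂ :=
  {z | ∃ s ∈ Set.Ico (0 : ℝ) 1, ∃ t ∈ Set.Ico (0 : ℝ) 1, z = s * γ 0 + t * γ 1}

/-- The average `⟨f⟩` of `f` over the torus: the integral over the period parallelogram, with
respect to Lebesgue measure, divided by the area. -/
def torusAverage (γ : Fin 2 → ℂ) (f : ℂ → ℂ) : ℂ :=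
  ⨍ z in parallelogram γ, f z

/-- `ψ = (ψ₁, ψ₂)` solves the linear system with spectral parameter `lam` whose compatibility
condition is the sinh-Gordon equation. -/
structure IsEigenfunction (u : ℂ → ℝ) (lam : ℂ) (ψ₁ ψ₂ : ℂ → ℂ) : Prop where
  differentiable_fst : Differentiable ℝ ψ₁
  differentiable_snd : Differentiable ℝ ψ₂
  del_fst : ∀ z, del ψ₁ z = (1 / 2) *
    (del (cplx u) z * ψ₁ z + Complex.I * (Real.exp (-u z) : ℂ) * ψ₂ z)
  del_snd : ∀ z, del ψ₂ z = (1 / 2) *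
    (Complex.I * lam⁻¹ * (Real.exp (u z) : ℂ) * ψ₁ z - del (cplx u) z * ψ₂ z)
  delbar_fst : ∀ z, delbar ψ₁ z = (1 / 2) *
    (-delbar (cplx u) z * ψ₁ z + Complex.I * lam * (Real.exp (u z) : ℂ) * ψ₂ z)
  delbar_snd : ∀ z, delbar ψ₂ z = (1 / 2) *
    (Complex.I * (Real.exp (-u z) : ℂ) * ψ₁ z + delbar (cplx u) z * ψ₂ z)

/-- The (affine part of the) spectral curve: the points `(lam, (μ₁, μ₂))` with `lam ≠ 0` for which
the linear system has a non-zero solution `ψ` that is multiplied by `μ₁, μ₂` under translation by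
the two periods. -/
def spectralCurve (u : ℂ → ℝ) (γ : Fin 2 → ℂ) : Set (ℂ × (Fin 2 → ℂ)) :=
  {p | p.1 ≠ 0 ∧ ∃ ψ₁ ψ₂ : ℂ → ℂ, IsEigenfunction u p.1 ψ₁ ψ₂ ∧
    (∃ z, ψ₁ z ≠ 0 ∨ ψ₂ z ≠ 0) ∧
    ∀ k z, ψ₁ (z + γ k) = p.2 k * ψ₁ z ∧ ψ₂ (z + γ k) = p.2 k * ψ₂ z}

theorem multiplier_ne_zero {u : ℂ → ℝ} {γ : Fin 2 → ℂ} {p : ℂ × (Fin 2 → ℂ)}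
    (hp : p ∈ spectralCurve u γ) (k : Fin 2) : p.2 k ≠ 0 := by
  obtain ⟨-, ψ₁, ψ₂, -, ⟨z, hz⟩, h⟩ := hp
  intro h0
  have h1 := h k (z - γ k)
  simp only [sub_add_cancel, h0, zero_mul] at h1
  tauto

/-- A holomorphically parametrized arc in a subset `S` of `ℂ × ℂ²`. -/
structure Arc (S : Set (ℂ × (Fin 2 → ℂ))) where
  domain : Set ℂ
  isOpen_domain : IsOpen domain
  toFun : ℂ → ℂ × (Fin 2 → ℂ)
  holomorphic : DifferentiableOn ℂ toFun domain
  mapsTo : Set.MapsTo toFun domain S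

/-- A holomorphic differential on (the normalization of) an analytic curve `S`, given by its
pullbacks `coeff c ζ dζ` to all holomorphic arcs `c` in `S`; the coefficients are holomorphic
and obey the transformation rule of differentials under holomorphic substitutions. -/
structure Differential (S : Set (ℂ × (Fin 2 → ℂ))) where
  coeff : Arc S → ℂ → ℂ
  holomorphic : ∀ c, DifferentiableOn ℂ (coeff c) c.domain
  pullback : ∀ (c d : Arc S) (φ : ℂ → ℂ), DifferentiableOn ℂ φ d.domain →
    Set.MapsTo φ d.domain c.domain → (∀ ζ ∈ d.domain, d.toFun ζ = c.toFun (φ ζ)) →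
    ∀ ζ ∈ d.domain, coeff d ζ = coeff c (φ ζ) * deriv φ ζ

theorem Arc.differentiableOn_mult {S : Set (ℂ × (Fin 2 → ℂ))} (c : Arc S) (k : Fin 2) :
    DifferentiableOn ℂ (fun ζ => (c.toFun ζ).2 k) c.domain :=
  (differentiableOn_pi.1 c.holomorphic.snd) k

/-- The differential `d ln μ_k` on the spectral curve. -/
def dlnMu (u : ℂ → ℝ) (γ : Fin 2 → ℂ) (k : Fin 2) : Differential (spectralCurve u γ) where
  coeff c ζ := deriv (fun w => (c.toFun w).2 k) ζ / (c.toFun ζ).2 k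
  holomorphic c := by
    have h := c.differentiableOn_mult k
    exact (h.deriv c.isOpen_domain).div h fun ζ hζ => multiplier_ne_zero (c.mapsTo hζ) k
  pullback c d φ hφ hm hd ζ hζ := by
    have hc := ((c.differentiableOn_mult k).differentiableAt
      (c.isOpen_domain.mem_nhds (hm hζ))).hasDerivAt
    have hp := (hφ.differentiableAt (d.isOpen_domain.mem_nhds hζ)).hasDerivAt
    have he : (fun w => (d.toFun w).2 k) =ᶠ[𝓝 ζ] (fun w => (c.toFun w).2 k) ∘ φ := by
      filter_upwards [d.isOpen_domain.mem_nhds hζ] with w hw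
      simp [hd w hw]
    rw [he.deriv_eq, (hc.comp ζ hp).deriv, hd ζ hζ]
    ring

/-- The relation `d ln μ_k = γ_k dp⁺ + γ̄_k dp⁻`, `k = 1, 2`, on the spectral curve. -/
def IsDpPair (u : ℂ → ℝ) (γ : Fin 2 → ℂ)
    (dpPlus dpMinus : Differential (spectralCurve u γ)) : Prop :=
  ∀ (k : Fin 2) (c : Arc (spectralCurve u γ)), ∀ ζ ∈ c.domain,
    (dlnMu u γ k).coeff c ζ = γ k * dpPlus.coeff c ζ + conj (γ k) * dpMinus.coeff c ζ

/-- Two differentials agree. -/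
def Differential.Agree {S : Set (ℂ × (Fin 2 → ℂ))} (θ η : Differential S) : Prop :=
  ∀ c, Set.EqOn (θ.coeff c) (η.coeff c) c.domain

/-- `c` exhibits the part of the curve `S` over a punctured disc around `lam = 0` as a punctured
disc with coordinate `ζ = lam ^ (1/2)`. Thus `S` has exactly one point `y⁺` over `lam = 0`, and
`lam ^ (1/2)` is the local parameter there. -/
def IsRootParamAtZero {S : Set (ℂ × (Fin 2 → ℂ))} (c : Arc S) : Prop :=
  ∃ r > 0, c.domain = Metric.ball 0 r \ {0} ∧
    (∀ ζ ∈ c.domain, (c.toFun ζ).1 = ζ ^ 2) ∧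
    Set.BijOn c.toFun c.domain {p | p ∈ S ∧ 0 < ‖p.1‖ ∧ ‖p.1‖ < r ^ 2}

/-- `c` exhibits the part of the curve `S` over a punctured disc around `lam = ∞` as a punctured
disc with coordinate `ξ = lam ^ (-1/2)`. Thus `S` has exactly one point `y⁻` over `lam = ∞`, and
`lam ^ (-1/2)` is the local parameter there. -/
def IsRootParamAtInfty {S : Set (ℂ × (Fin 2 → ℂ))} (c : Arc S) : Prop :=
  ∃ r > 0, c.domain = Metric.ball 0 r \ {0} ∧
    (∀ ξ ∈ c.domain, (c.toFun ξ).1 = (ξ ^ 2)⁻¹) ∧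
    Set.BijOn c.toFun c.domain {p | p ∈ S ∧ (r ^ 2)⁻¹ < ‖p.1‖}

/-- A function on a punctured neighbourhood of `0` extends holomorphically to `0`. -/
def ExtendsHolomorphically (f : ℂ → ℂ) : Prop :=
  ∃ g : ℂ → ℂ, AnalyticAt ℂ g 0 ∧ f =ᶠ[𝓝[≠] 0] g

end SinhGordon

end

open SinhGordon

/-! Near `λ = 0` put `λ = ζ²`. The leading part of the `∂`-equation has eigenvalues `±i/(2ζ)` with
eigenvectors `(±ζ e^{-u/2}, e^{u/2})`, so one looks for Floquet solutions `ψ = (ζ e^{-u/2}(1+ζp) f,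
e^{u/2}(1-ζp) f)` with a periodic function `p` and a scalar factor `f`. The linear system turns into
two Riccati equations for `p` and two equations for `ln f`. The Riccati equation in `∂` is singular
at `ζ = 0`, but the one in `∂̄`, namely `∂̄p = (i/2)(sinh 2u - 2ζ cosh 2u p + ζ² sinh 2u p²)`, is
regular there. At `ζ = 0` it has the solution `p = -i∂u`, by the sinh-Gordon equation.

The `∂̄`-equation is solved for small `ζ` by the implicit function theorem in a weighted Wiener
algebra of Fourier coefficients (`exists_riccati_family`). The free constant in `p` is fixed by the
condition that the right-hand side have mean zero, which is a nondegenerate condition because `⟨cosh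
2u⟩ ≠ 0`. The `∂`-equation then comes for free: its defect `R` satisfies `∂̄R = aR` with `a`
periodic of small non-zero mean, and a Liouville argument (`eq_zero_of_delbar_eq_mul`) gives `R =
0`. The same kind of argument integrates `f` to `exp(κ⁺z + κ⁻z̄ + periodic)`, with `κ⁺ = i/(2ζ) +
ζα` and `κ⁻ = (i/2)ζβ`, where `α = ⟨∂u p⟩` and `β = ⟨cosh 2u⟩ - ζ⟨sinh 2u p⟩`. Hence `ln μ_k = γ_k
κ⁺ + γ̄_k κ⁻` up to multiples of `2πi`.

The solutions for `ζ` and `-ζ` belong to the same `λ`. Their Wronskian is constant and non-zero, so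
their multipliers are mutually inverse, and this makes `α` and `β` even in `ζ` (`IsGoodParam.even`);
evenness is what turns the error terms into `O(λ)`. The two solutions span all solutions, so they
account for the whole curve over a punctured disc, and their multipliers differ, so `ζ` is a
coordinate there (`exists_arc_at_zero`).

The point `λ = ∞` reduces to `λ = 0` by `z ↦ z̄`, `λ ↦ λ⁻¹`. The differentials exist and are unique
by Cramer's rule, since `γ₀γ̄₁ - γ₁γ̄₀ ≠ 0`; their expansions are the derivatives of `κ⁺` and `κ⁻`.
-/

/-! ### Wirtinger calculus -/

/-- The real-linear map `v ↦ a v + b v̄`. -/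
noncomputable def wirtingerMap (a b : ℂ) : ℂ →L[ℝ] ℂ :=
  a • (ContinuousLinearMap.id ℝ ℂ) + b • (Complex.conjCLE : ℂ →L[ℝ] ℂ)

theorem wirtingerMap_apply (a b v : ℂ) : wirtingerMap a b v = a * v + b * conj v := by
  simp [wirtingerMap]

/-- `f` is real differentiable at `z` with Wirtinger derivatives `a = ∂f(z)`, `b = ∂̄f(z)`. -/
def HasW (f : ℂ → ℂ) (a b z : ℂ) : Prop := HasFDerivAt f (wirtingerMap a b) z

theorem HasW.del_eq {f : ℂ → ℂ} {a b z : ℂ} (h : HasW f a b z) : del f z = a := by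
  have h' : fderiv ℝ f z = wirtingerMap a b := HasFDerivAt.fderiv h
  simp only [del, h', wirtingerMap_apply, map_one, Complex.conj_I]
  linear_combination (-a / 2 + b / 2) * Complex.I_sq

theorem HasW.delbar_eq {f : ℂ → ℂ} {a b z : ℂ} (h : HasW f a b z) : delbar f z = b := by
  have h' : fderiv ℝ f z = wirtingerMap a b := HasFDerivAt.fderiv h
  simp only [delbar, h', wirtingerMap_apply, map_one, Complex.conj_I]
  linear_combination (a / 2 - b / 2) * Complex.I_sq

theorem HasW.differentiableAt {f : ℂ → ℂ} {a b z : ℂ} (h : HasW f a b z) :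
    DifferentiableAt ℝ f z := HasFDerivAt.differentiableAt h

theorem realLinear_eq_wirtingerMap (L : ℂ →L[ℝ] ℂ) :
    L = wirtingerMap ((1 / 2) * (L 1 - Complex.I * L Complex.I))
      ((1 / 2) * (L 1 + Complex.I * L Complex.I)) := by
  ext v
  have hv : L v = v.re * L 1 + v.im * L Complex.I := by
    conv_lhs => rw [← Complex.re_add_im v]
    have h1 : (v.re : ℂ) = v.re • (1 : ℂ) := by simp
    have h2 : (v.im : ℂ) * Complex.I = v.im • Complex.I := by simp
    rw [map_add, h2, h1, map_smul, map_smul]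
    simp
  have h3 : conj v = v.re - v.im * Complex.I := by
    apply Complex.ext <;> simp
  rw [hv, wirtingerMap_apply, h3]
  conv_rhs => rw [← Complex.re_add_im v]
  simp only [Complex.add_re, Complex.ofReal_re, Complex.mul_re, Complex.I_re, mul_zero,
    Complex.ofReal_im, Complex.I_im, mul_one, sub_self, add_zero, Complex.add_im, Complex.mul_im,
    zero_add]
  linear_combination (v.im * L Complex.I) * Complex.I_sq

theorem hasW_of_differentiableAt {f : ℂ → ℂ} {z : ℂ} (h : DifferentiableAt ℝ f z) :
    HasW f (del f z) (delbar f z) z := by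
  have := h.hasFDerivAt
  rw [realLinear_eq_wirtingerMap (fderiv ℝ f z)] at this
  exact this

theorem HasW.congr_deriv {f : ℂ → ℂ} {a b a' b' z : ℂ} (h : HasW f a b z) (ha : a = a')
    (hb : b = b') : HasW f a' b' z := by subst ha; subst hb; exact h

theorem hasW_const (c z : ℂ) : HasW (fun _ => c) 0 0 z := by
  have : wirtingerMap 0 0 = 0 := by ext; simp [wirtingerMap]
  unfold HasW; rw [this]; exact hasFDerivAt_const c z

theorem hasW_id (z : ℂ) : HasW (fun w => w) 1 0 z := by
  have : wirtingerMap 1 0 = ContinuousLinearMap.id ℝ ℂ := by ext; simp [wirtingerMap_apply]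
  unfold HasW; rw [this]; exact hasFDerivAt_id z

theorem hasW_conj (z : ℂ) : HasW (fun w => conj w) 0 1 z := by
  have : wirtingerMap 0 1 = (Complex.conjCLE : ℂ →L[ℝ] ℂ) := by
    ext; simp [wirtingerMap_apply]
  unfold HasW; rw [this]; exact (Complex.conjCLE : ℂ →L[ℝ] ℂ).hasFDerivAt

theorem HasW.add {f g : ℂ → ℂ} {a b c d z : ℂ} (hf : HasW f a b z) (hg : HasW g c d z) :
    HasW (fun w => f w + g w) (a + c) (b + d) z := by
  refine (HasFDerivAt.add hf hg).congr_fderiv ?_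
  ext v; simp only [add_apply, wirtingerMap_apply]; ring

theorem HasW.sub {f g : ℂ → ℂ} {a b c d z : ℂ} (hf : HasW f a b z) (hg : HasW g c d z) :
    HasW (fun w => f w - g w) (a - c) (b - d) z := by
  refine (HasFDerivAt.sub hf hg).congr_fderiv ?_
  ext v; simp only [sub_apply, wirtingerMap_apply]; ring

theorem HasW.mul {f g : ℂ → ℂ} {a b c d z : ℂ} (hf : HasW f a b z) (hg : HasW g c d z) :
    HasW (fun w => f w * g w) (a * g z + f z * c) (b * g z + f z * d) z := by
  refine (HasFDerivAt.mul hf hg).congr_fderiv ?_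
  ext v
  simp only [add_apply, smul_apply, wirtingerMap_apply,
    smul_eq_mul]
  ring

theorem HasW.const_mul {f : ℂ → ℂ} {a b z : ℂ} (c : ℂ) (hf : HasW f a b z) :
    HasW (fun w => c * f w) (c * a) (c * b) z :=
  ((hasW_const c z).mul hf).congr_deriv (by ring) (by ring)

theorem HasW.comp_holomorphic {f h : ℂ → ℂ} {a b h' z : ℂ} (hf : HasW f a b z)
    (hh : HasDerivAt h h' (f z)) : HasW (fun w => h (f w)) (h' * a) (h' * b) z := by
  have := (hh.hasFDerivAt.restrictScalars ℝ).comp z (show HasFDerivAt f _ z from hf)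
  refine this.congr_fderiv ?_
  ext v
  simp only [ContinuousLinearMap.comp_apply, ContinuousLinearMap.coe_restrictScalars',
    wirtingerMap_apply, ContinuousLinearMap.toSpanSingleton_apply, smul_eq_mul]
  ring

theorem HasW.cexp {f : ℂ → ℂ} {a b z : ℂ} (hf : HasW f a b z) :
    HasW (fun w => Complex.exp (f w)) (Complex.exp (f z) * a) (Complex.exp (f z) * b) z :=
  hf.comp_holomorphic (Complex.hasDerivAt_exp _)

theorem HasW.comp_conj {f : ℂ → ℂ} {a b z : ℂ} (hf : HasW f a b (conj z)) :
    HasW (fun w => f (conj w)) b a z := by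
  have := HasFDerivAt.comp z (show HasFDerivAt f _ (conj z) from hf)
    (Complex.conjCLE : ℂ →L[ℝ] ℂ).hasFDerivAt
  refine this.congr_fderiv ?_
  ext v
  simp only [ContinuousLinearMap.comp_apply, wirtingerMap_apply, ContinuousLinearEquiv.coe_coe,
    Complex.conjCLE_apply, Complex.conj_conj]
  ring

theorem HasW.hasDerivAt {f : ℂ → ℂ} {a z : ℂ} (hf : HasW f a 0 z) : HasDerivAt f a z := by
  rw [hasDerivAt_iff_hasFDerivAt]
  refine hasFDerivAt_of_restrictScalars ℝ hf ?_
  ext v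
  simp [wirtingerMap_apply, mul_comm]

/-- Liouville's theorem in terms of `∂̄`. -/
theorem eq_of_bounded_of_hasW {f a : ℂ → ℂ} {C : ℝ} (hf : ∀ z, HasW f (a z) 0 z)
    (hb : ∀ z, ‖f z‖ ≤ C) (z w : ℂ) : f z = f w := by
  have hd : Differentiable ℂ f := fun z => (hf z).hasDerivAt.differentiableAt
  refine hd.apply_eq_apply_of_bounded ?_ z w
  refine isBounded_iff_forall_norm_le.2 ⟨C, ?_⟩
  rintro _ ⟨z, rfl⟩
  exact hb z

/-- A function with vanishing Wirtinger derivatives is constant. -/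
theorem eq_of_hasW_zero {f : ℂ → ℂ} (hf : ∀ z, HasW f 0 0 z) (z w : ℂ) : f z = f w := by
  have h0 : wirtingerMap 0 0 = 0 := by ext; simp [wirtingerMap]
  refine is_const_of_fderiv_eq_zero (𝕜 := ℝ) (fun z => (hf z).differentiableAt) (fun z => ?_) z w
  rw [← h0]; exact HasFDerivAt.fderiv (hf z)

theorem del_delbar_comm {f : ℂ → ℂ} (hf : ContDiff ℝ ∞ f) (z : ℂ) :
    del (delbar f) z = delbar (del f) z := by
  have hd : ∀ v : ℂ, Differentiable ℝ (fun w => fderiv ℝ f w v) := fun v =>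
    ((hf.fderiv_right (m := 1) (by norm_cast)).clm_apply contDiff_const).differentiable (by simp)
  have h2 : DifferentiableAt ℝ (fderiv ℝ f) z :=
    ((hf.fderiv_right (m := 1) (by norm_cast)).differentiable (by simp)) z
  have hv : ∀ v : ℂ, fderiv ℝ (fun w => fderiv ℝ f w v) z = (fderiv ℝ (fderiv ℝ f) z).flip v := by
    intro v
    ext x
    have := fderiv_clm_apply h2 (differentiableAt_const v)
    rw [this]; simp
  have hs : fderiv ℝ (fderiv ℝ f) z 1 Complex.I = fderiv ℝ (fderiv ℝ f) z Complex.I 1 := by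
    have : IsSymmSndFDerivAt ℝ f z := hf.contDiffAt.isSymmSndFDerivAt (by simpa using WithTop.coe_le_coe.2 (le_top : (2 : ℕ∞) ≤ ⊤))
    exact this 1 Complex.I
  have e1 : HasFDerivAt (delbar f) ((1 / 2 : ℂ) • ((fderiv ℝ (fderiv ℝ f) z).flip 1
      + Complex.I • (fderiv ℝ (fderiv ℝ f) z).flip Complex.I)) z := by
    have a1 := (hd 1 z).hasFDerivAt
    have a2 := (hd Complex.I z).hasFDerivAt
    rw [hv] at a1 a2
    exact (a1.add (a2.const_mul Complex.I)).const_mul (1 / 2)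
  have e2 : HasFDerivAt (del f) ((1 / 2 : ℂ) • ((fderiv ℝ (fderiv ℝ f) z).flip 1
      - Complex.I • (fderiv ℝ (fderiv ℝ f) z).flip Complex.I)) z := by
    have a1 := (hd 1 z).hasFDerivAt
    have a2 := (hd Complex.I z).hasFDerivAt
    rw [hv] at a1 a2
    exact (a1.sub (a2.const_mul Complex.I)).const_mul (1 / 2)
  rw [del, delbar, e1.fderiv, e2.fderiv]
  simp only [smul_apply, add_apply,
    sub_apply, ContinuousLinearMap.flip_apply, smul_eq_mul, hs]
  ring

theorem contDiff_del {f : ℂ → ℂ} (hf : ContDiff ℝ ∞ f) : ContDiff ℝ ∞ (del f) := by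
  have hd : ∀ v : ℂ, ContDiff ℝ ∞ (fun w => fderiv ℝ f w v) := fun v =>
    (hf.fderiv_right (m := ∞) (by norm_cast)).clm_apply contDiff_const
  exact contDiff_const.mul ((hd 1).sub (contDiff_const.mul (hd Complex.I)))

/-! ### The period lattice and the characters of the torus -/

/-- The determinant `γ₀ γ̄₁ - γ₁ γ̄₀` of a pair of periods. -/
noncomputable def periodDet (γ : Fin 2 → ℂ) : ℂ := γ 0 * conj (γ 1) - γ 1 * conj (γ 0)

theorem eq_zero_of_periodDet_eq_zero {a b : ℂ} (h : a * conj b - b * conj a = 0) :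
    ∃ s t : ℝ, (s ≠ 0 ∨ t ≠ 0) ∧ s * a + t * b = 0 := by
  -- Up to a factor, the determinant is the imaginary part of `a b̄`, the oriented area spanned by
  -- `a` and `b`.
  have him : a.im * b.re = a.re * b.im := by
    have := congrArg Complex.im h
    simp at this
    linarith
  by_cases ha : a = 0
  · exact ⟨1, 0, by simp, by simp [ha]⟩
  · by_cases hr : a.re = 0
    · have hi : a.im ≠ 0 := fun hi => ha (Complex.ext hr hi)
      refine ⟨b.im, -a.im, Or.inr (by simpa using hi), ?_⟩
      apply Complex.ext <;> simp
      · linarith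
      · ring
    · refine ⟨b.re, -a.re, Or.inr (by simpa using hr), ?_⟩
      apply Complex.ext <;> simp
      · ring
      · linarith

theorem periodDet_ne_zero {γ : Fin 2 → ℂ} (hγ : LinearIndependent ℝ γ) : periodDet γ ≠ 0 := by
  intro h
  obtain ⟨s, t, hst, h0⟩ := eq_zero_of_periodDet_eq_zero h
  have := Fintype.linearIndependent_iff.1 hγ ![s, t] (by simpa [Fin.sum_univ_two] using h0)
  have h1 := this 0
  have h2 := this 1
  simp at h1 h2
  tauto

theorem conj_periodDet (γ : Fin 2 → ℂ) : conj (periodDet γ) = -periodDet γ := by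
  simp [periodDet]; ring

/-- The linear system `a γ_k + b γ̄_k = 0`, `k = 0, 1`, has only the trivial solution. -/
theorem eq_zero_of_forall_period {γ : Fin 2 → ℂ} (hγ : LinearIndependent ℝ γ) {a b : ℂ}
    (h : ∀ k, a * γ k + b * conj (γ k) = 0) : a = 0 ∧ b = 0 := by
  have hd := periodDet_ne_zero hγ
  constructor
  · apply (mul_eq_zero.1 (_ : a * periodDet γ = 0)).resolve_right hd
    unfold periodDet
    linear_combination conj (γ 1) * h 0 - conj (γ 0) * h 1
  · apply (mul_eq_zero.1 (_ : b * periodDet γ = 0)).resolve_right hd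
    unfold periodDet
    linear_combination γ 0 * h 1 - γ 1 * h 0

/-- The frequency `∂` of the character of the torus with index `n`. -/
noncomputable def freq (γ : Fin 2 → ℂ) (n : Fin 2 → ℤ) : ℂ :=
  2 * Real.pi * Complex.I * (n 0 * conj (γ 1) - n 1 * conj (γ 0)) / periodDet γ

/-- The character of the torus `ℂ / (ℤ γ 0 + ℤ γ 1)` with index `n`. -/
noncomputable def character (γ : Fin 2 → ℂ) (n : Fin 2 → ℤ) (z : ℂ) : ℂ :=
  Complex.exp (freq γ n * z - conj (freq γ n) * conj z)

theorem freq_add (γ : Fin 2 → ℂ) (n m : Fin 2 → ℤ) : freq γ (n + m) = freq γ n + freq γ m := by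
  simp [freq]; ring

@[simp] theorem freq_zero (γ : Fin 2 → ℂ) : freq γ 0 = 0 := by simp [freq]

/-- The frequency is the Cramer solution of exactly these two equations; they make the character
invariant under the periods. -/
theorem freq_mul_period {γ : Fin 2 → ℂ} (hγ : LinearIndependent ℝ γ) (n : Fin 2 → ℤ) (k : Fin 2) :
    freq γ n * γ k - conj (freq γ n) * conj (γ k) = 2 * Real.pi * Complex.I * n k := by
  have hd := periodDet_ne_zero hγ
  have hc : conj (freq γ n) = 2 * Real.pi * Complex.I * (n 0 * γ 1 - n 1 * γ 0) / periodDet γ := by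
    simp [freq, conj_periodDet, map_ofNat]
  rw [hc, freq]
  field_simp
  fin_cases k
  · simp [periodDet]; ring
  · simp [periodDet]; ring

theorem character_add_period {γ : Fin 2 → ℂ} (hγ : LinearIndependent ℝ γ) (n : Fin 2 → ℤ)
    (k : Fin 2) (z : ℂ) : character γ n (z + γ k) = character γ n z := by
  have h := freq_mul_period hγ n k
  have : freq γ n * (z + γ k) - conj (freq γ n) * conj (z + γ k)
      = (freq γ n * z - conj (freq γ n) * conj z) + n k * (2 * Real.pi * Complex.I) := by
    rw [map_add]; linear_combination h
  rw [character, this, Complex.exp_add, Complex.exp_int_mul_two_pi_mul_I, mul_one, character]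

theorem character_add_index (γ : Fin 2 → ℂ) (n m : Fin 2 → ℤ) (z : ℂ) :
    character γ (n + m) z = character γ n z * character γ m z := by
  rw [character, character, character, ← Complex.exp_add, freq_add, map_add]
  ring_nf

@[simp] theorem character_zero_index (γ : Fin 2 → ℂ) (z : ℂ) : character γ 0 z = 1 := by
  simp [character]

theorem norm_exp_sub_conj (w : ℂ) : ‖Complex.exp (w - conj w)‖ = 1 := by
  rw [Complex.norm_exp]; simp

@[simp] theorem norm_character (γ : Fin 2 → ℂ) (n : Fin 2 → ℤ) (z : ℂ) :
    ‖character γ n z‖ = 1 := by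
  rw [character, ← map_mul, norm_exp_sub_conj]

theorem hasW_character (γ : Fin 2 → ℂ) (n : Fin 2 → ℤ) (z : ℂ) :
    HasW (character γ n) (freq γ n * character γ n z) (-conj (freq γ n) * character γ n z) z := by
  have := (((hasW_id z).const_mul (freq γ n)).sub
    ((hasW_conj z).const_mul (conj (freq γ n)))).cexp
  exact this.congr_deriv (by simp [character, mul_comm]) (by simp [character, mul_comm])

/-- The frequencies of non-trivial characters are bounded away from `0`. -/
theorem exists_freq_lower_bound {γ : Fin 2 → ℂ} (hγ : LinearIndependent ℝ γ) :
    ∃ C : ℝ, 0 < C ∧ ∀ n : Fin 2 → ℤ, n ≠ 0 → 1 ≤ C * ‖freq γ n‖ := by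
  refine ⟨‖γ 0‖ + ‖γ 1‖, ?_, ?_⟩
  · have : γ 0 ≠ 0 := hγ.ne_zero 0
    positivity
  · intro n hn
    obtain ⟨k, hk⟩ : ∃ k, n k ≠ 0 := by
      by_contra! h; exact hn (funext h)
    have h1 : ‖freq γ n * γ k - conj (freq γ n) * conj (γ k)‖ = 2 * Real.pi * |(n k : ℝ)| := by
      rw [freq_mul_period hγ]; simp [abs_of_pos Real.pi_pos]
    have h2 : ‖freq γ n * γ k - conj (freq γ n) * conj (γ k)‖ ≤ 2 * (‖freq γ n‖ * ‖γ k‖) := by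
      refine (norm_sub_le _ _).trans ?_
      simp only [norm_mul, RCLike.norm_conj]; linarith
    have h3 : (1 : ℝ) ≤ |(n k : ℝ)| := by
      exact_mod_cast Int.one_le_abs hk
    have h4 : ‖γ k‖ ≤ ‖γ 0‖ + ‖γ 1‖ := by
      fin_cases k
      · simp
      · simp
    have h5 := mul_le_mul_of_nonneg_left h4 (norm_nonneg (freq γ n))
    have h6 := Real.pi_gt_three
    nlinarith

/-! ### Trigonometric series and the weighted Wiener algebra -/

/-- The trigonometric series with coefficients `c`. -/
noncomputable def trigSeries (γ : Fin 2 → ℂ) (c : (Fin 2 → ℤ) → ℂ) (z : ℂ) : ℂ :=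
  ∑' n, c n * character γ n z

theorem summable_trig {c : (Fin 2 → ℤ) → ℂ} (γ : Fin 2 → ℂ) (hc : Summable c) (z : ℂ) :
    Summable fun n => c n * character γ n z :=
  Summable.of_norm (by simpa using hc.norm)

theorem norm_trigSeries_le {c : (Fin 2 → ℤ) → ℂ} (γ : Fin 2 → ℂ) (hc : Summable c) (z : ℂ) :
    ‖trigSeries γ c z‖ ≤ ∑' n, ‖c n‖ := by
  refine (norm_tsum_le_tsum_norm (by simpa using hc.norm)).trans_eq ?_
  simp

theorem trigSeries_add_period {γ : Fin 2 → ℂ} (hγ : LinearIndependent ℝ γ)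
    (c : (Fin 2 → ℤ) → ℂ) (k : Fin 2) (z : ℂ) :
    trigSeries γ c (z + γ k) = trigSeries γ c z := by
  simp only [trigSeries, character_add_period hγ]

theorem hasW_trigSeries {c : (Fin 2 → ℤ) → ℂ} (γ : Fin 2 → ℂ) (hc : Summable c)
    (hc' : Summable fun n => freq γ n * c n) (z : ℂ) :
    HasW (trigSeries γ c) (trigSeries γ (fun n => freq γ n * c n) z)
      (trigSeries γ (fun n => -conj (freq γ n) * c n) z) z := by
  have hd : ∀ n w, HasFDerivAt (fun w => c n * character γ n w)
      (wirtingerMap (freq γ n * c n * character γ n w)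
        (-conj (freq γ n) * c n * character γ n w)) w := fun n w =>
    ((hasW_character γ n w).const_mul (c n)).congr_deriv (by ring) (by ring)
  have hc'' : Summable fun n => -conj (freq γ n) * c n :=
    Summable.of_norm (by simpa using hc'.norm)
  have hb : ∀ n w, ‖wirtingerMap (freq γ n * c n * character γ n w)
        (-conj (freq γ n) * c n * character γ n w)‖ ≤ 2 * ‖freq γ n * c n‖ := by
    intro n w
    refine ContinuousLinearMap.opNorm_le_bound _ (by positivity) fun v => ?_
    rw [wirtingerMap_apply]
    refine (norm_add_le _ _).trans_eq ?_
    simp; ring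
  have key := hasFDerivAt_tsum (hc'.norm.mul_left 2) hd hb (summable_trig γ hc 0) z
  refine HasFDerivAt.congr_fderiv key ?_
  have hs : Summable fun n => wirtingerMap (freq γ n * c n * character γ n z)
        (-conj (freq γ n) * c n * character γ n z) :=
    Summable.of_norm_bounded (hc'.norm.mul_left 2) fun n => hb n z
  ext v
  rw [wirtingerMap_apply, trigSeries, trigSeries, ← tsum_mul_right, ← tsum_mul_right]
  have h1 := (summable_trig γ hc' z).mul_right v
  have h2 := (summable_trig γ hc'' z).mul_right (conj v)
  rw [← h1.tsum_add h2]
  have := (ContinuousLinearMap.apply ℝ ℂ v).map_tsum hs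
  simpa [wirtingerMap_apply] using this

/-- Absolutely summable families indexed by the characters of the torus. -/
noncomputable abbrev TorusSeq : Type := lp (fun _ : Fin 2 → ℤ => ℂ) 1

theorem TorusSeq.summable_norm (a : TorusSeq) : Summable fun n => ‖a n‖ := by
  simpa using (memℓp_gen_iff (by simp)).1 (lp.memℓp a)

theorem TorusSeq.norm_eq (a : TorusSeq) : ‖a‖ = ∑' n, ‖a n‖ := by
  simpa using lp.norm_eq_tsum_rpow (by simp) a

/-- The element of `TorusSeq` supported at a single index. -/
noncomputable def torusSingle (n : Fin 2 → ℤ) : TorusSeq := lp.single 1 n (1 : ℂ)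

theorem torusSingle_apply (n m : Fin 2 → ℤ) : torusSingle n m = if m = n then 1 else 0 := by
  simp [torusSingle, Pi.single_apply]

theorem norm_torusSingle (n : Fin 2 → ℤ) : ‖torusSingle n‖ = 1 := by
  rw [torusSingle, lp.norm_single (by simp)]; simp

section lift
variable {E : Type*} [NormedAddCommGroup E] [NormedSpace ℂ E]

/-- The finite combinations of basis elements are dense in `ℓ¹`. Together with `lpLift` this reduces
identities between operators to identities between characters. -/
theorem torusSeq_clm_ext {f g : TorusSeq →L[ℂ] E} (h : ∀ n, f (torusSingle n) = g (torusSingle n)) :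
    f = g := by
  refine lp.ext_continuousLinearMap (by simp) fun n => ?_
  ext
  simpa [torusSingle] using h n

variable [CompleteSpace E]

theorem summable_smul_of_bound (v : (Fin 2 → ℤ) → E) {C : ℝ} (h : ∀ n, ‖v n‖ ≤ C)
    (a : TorusSeq) : Summable fun n => a n • v n := by
  refine Summable.of_norm_bounded ((TorusSeq.summable_norm a).mul_right C) fun n => ?_
  rw [norm_smul]
  exact mul_le_mul_of_nonneg_left (h n) (norm_nonneg _)

/-- The continuous linear map on `TorusSeq` with prescribed bounded values on the basis. -/
noncomputable def lpLift (v : (Fin 2 → ℤ) → E) (C : ℝ) (h : ∀ n, ‖v n‖ ≤ C) :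
    TorusSeq →L[ℂ] E :=
  LinearMap.mkContinuous
    { toFun := fun a => ∑' n, a n • v n
      map_add' := fun a b => by
        simp only [lp.coeFn_add, Pi.add_apply, add_smul]
        exact (summable_smul_of_bound v h a).tsum_add (summable_smul_of_bound v h b)
      map_smul' := fun c a => by
        simp only [lp.coeFn_smul, Pi.smul_apply, smul_assoc, RingHom.id_apply]
        exact (summable_smul_of_bound v h a).tsum_const_smul c } C (fun a => by
      rw [TorusSeq.norm_eq, ← tsum_mul_left]
      refine tsum_of_norm_bounded ((TorusSeq.summable_norm a).mul_left C).hasSum fun n => ?_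
      rw [norm_smul, mul_comm]
      exact mul_le_mul_of_nonneg_right (h n) (norm_nonneg _))

theorem lpLift_apply (v : (Fin 2 → ℤ) → E) (C : ℝ) (h : ∀ n, ‖v n‖ ≤ C) (a : TorusSeq) :
    lpLift v C h a = ∑' n, a n • v n := rfl

theorem norm_lpLift_le (v : (Fin 2 → ℤ) → E) (C : ℝ) (h : ∀ n, ‖v n‖ ≤ C) :
    ‖lpLift v C h‖ ≤ C :=
  LinearMap.mkContinuous_norm_le _ ((norm_nonneg _).trans (h 0)) _

theorem lpLift_single (v : (Fin 2 → ℤ) → E) (C : ℝ) (h : ∀ n, ‖v n‖ ≤ C) (n : Fin 2 → ℤ) :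
    lpLift v C h (torusSingle n) = v n := by
  rw [lpLift_apply, tsum_eq_single n]
  · simp [torusSingle_apply]
  · intro m hm; simp [torusSingle_apply, hm]

end lift

/-- Weights on the index set of the characters: the coefficient of a character in the function
represented by `a : TorusSeq` is `a n / weight n`. -/
noncomputable def weight (γ : Fin 2 → ℂ) (n : Fin 2 → ℤ) : ℂ := (((1 + ‖freq γ n‖) ^ 2 : ℝ) : ℂ)

theorem norm_weight (γ : Fin 2 → ℂ) (n : Fin 2 → ℤ) : ‖weight γ n‖ = (1 + ‖freq γ n‖) ^ 2 := by
  rw [weight, Complex.norm_real, Real.norm_of_nonneg (by positivity)]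

theorem weight_ne_zero (γ : Fin 2 → ℂ) (n : Fin 2 → ℤ) : weight γ n ≠ 0 := by
  rw [← norm_pos_iff, norm_weight]; positivity

@[simp] theorem weight_zero (γ : Fin 2 → ℂ) : weight γ 0 = 1 := by simp [weight]

/-- Submultiplicativity of the weight, from `1 + |x + y| ≤ (1 + |x|)(1 + |y|)`; it makes the
weighted space closed under products. The exponent 2 of the weight leaves room for two termwise
derivatives. -/
theorem norm_weight_add_le (γ : Fin 2 → ℂ) (n m : Fin 2 → ℤ) :
    ‖weight γ (n + m) / (weight γ n * weight γ m)‖ ≤ 1 := by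
  rw [norm_div, norm_mul, norm_weight, norm_weight, norm_weight, div_le_one (by positivity),
    freq_add, ← mul_pow]
  gcongr
  have := norm_add_le (freq γ n) (freq γ m)
  nlinarith [norm_nonneg (freq γ n), norm_nonneg (freq γ m),
    mul_nonneg (norm_nonneg (freq γ n)) (norm_nonneg (freq γ m))]

theorem summable_weighted (γ : Fin 2 → ℂ) (a : TorusSeq) (s : (Fin 2 → ℤ) → ℂ)
    (hs : ∀ n, ‖s n‖ ≤ ‖weight γ n‖) : Summable fun n => s n * (a n / weight γ n) := by
  refine Summable.of_norm_bounded (TorusSeq.summable_norm a) fun n => ?_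
  rw [norm_mul, norm_div, mul_div_assoc', div_le_iff₀ (norm_pos_iff.2 (weight_ne_zero γ n)),
    mul_comm]
  exact mul_le_mul_of_nonneg_left (hs n) (norm_nonneg _)

theorem one_le_norm_weight (γ : Fin 2 → ℂ) (n : Fin 2 → ℤ) : 1 ≤ ‖weight γ n‖ := by
  rw [norm_weight]; nlinarith [norm_nonneg (freq γ n)]

theorem summable_div_weight (γ : Fin 2 → ℂ) (a : TorusSeq) :
    Summable fun n => a n / weight γ n := by
  simpa using summable_weighted γ a (fun _ => 1) (by simpa using one_le_norm_weight γ)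

theorem summable_freq_div_weight (γ : Fin 2 → ℂ) (a : TorusSeq) :
    Summable fun n => freq γ n * (a n / weight γ n) :=
  summable_weighted γ a _ fun n => by rw [norm_weight]; nlinarith [norm_nonneg (freq γ n)]

theorem summable_freq_freq_div_weight (γ : Fin 2 → ℂ) (a : TorusSeq) :
    Summable fun n => freq γ n * (freq γ n * (a n / weight γ n)) := by
  simpa [mul_assoc] using summable_weighted γ a (fun n => freq γ n * freq γ n) fun n => by
    rw [norm_weight, norm_mul]; nlinarith [norm_nonneg (freq γ n)]

/-- The function on the torus represented by `a : TorusSeq`. -/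
noncomputable def synth (γ : Fin 2 → ℂ) (a : TorusSeq) : ℂ → ℂ :=
  trigSeries γ fun n => a n / weight γ n

/-- The derivative `∂` of the function represented by `a`. -/
noncomputable def synthDel (γ : Fin 2 → ℂ) (a : TorusSeq) : ℂ → ℂ :=
  trigSeries γ fun n => freq γ n * (a n / weight γ n)

/-- The derivative `∂̄` of the function represented by `a`. -/
noncomputable def synthDelbar (γ : Fin 2 → ℂ) (a : TorusSeq) : ℂ → ℂ :=
  trigSeries γ fun n => -conj (freq γ n) * (a n / weight γ n)

theorem hasW_synth (γ : Fin 2 → ℂ) (a : TorusSeq) (z : ℂ) :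
    HasW (synth γ a) (synthDel γ a z) (synthDelbar γ a z) z :=
  hasW_trigSeries γ (summable_div_weight γ a) (summable_freq_div_weight γ a) z

/-- The mixed second derivatives of a synthesized function agree. -/
theorem exists_hasW_synthDel {γ : Fin 2 → ℂ} {a : TorusSeq} {z x y : ℂ} {G : ℂ → ℂ}
    (hG : ∀ w, synthDelbar γ a w = G w) (hW : HasW G x y z) :
    ∃ t, HasW (synthDel γ a) t x z := by
  have h1 := hasW_trigSeries γ (summable_freq_div_weight γ a) (summable_freq_freq_div_weight γ a) z
  have h2 := hasW_trigSeries (c := fun n => -conj (freq γ n) * (a n / weight γ n)) γ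
    (Summable.of_norm (by simpa using (summable_freq_div_weight γ a).norm))
    (Summable.of_norm (by simpa using (summable_freq_freq_div_weight γ a).norm)) z
  have h3 : synthDelbar γ a = G := funext hG
  have h4 := h2.del_eq
  rw [show trigSeries γ (fun n => -conj (freq γ n) * (a n / weight γ n)) = G from h3,
    -- Termwise, `∂̄∂` and `∂∂̄` multiply the coefficients by the same number, so `∂̄` of `∂a` is
    -- read off from `∂G`.
    hW.del_eq] at h4
  refine ⟨_, HasW.congr_deriv h1 rfl ?_⟩
  rw [h4]
  congr 1
  ext n; ring

theorem synth_add_period {γ : Fin 2 → ℂ} (hγ : LinearIndependent ℝ γ) (a : TorusSeq) (k : Fin 2)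
    (z : ℂ) : synth γ a (z + γ k) = synth γ a z :=
  trigSeries_add_period hγ _ k z

/-- Evaluation of the represented function at a point. -/
noncomputable def synthCLM (γ : Fin 2 → ℂ) (z : ℂ) : TorusSeq →L[ℂ] ℂ :=
  lpLift (fun n => character γ n z / weight γ n) 1 fun n => by
    rw [norm_div, norm_character, div_le_one (norm_pos_iff.2 (weight_ne_zero γ n))]
    exact one_le_norm_weight γ n

theorem synthCLM_apply (γ : Fin 2 → ℂ) (z : ℂ) (a : TorusSeq) :
    synthCLM γ z a = synth γ a z := by
  rw [synthCLM, lpLift_apply, synth, trigSeries]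
  congr 1; ext n; rw [smul_eq_mul]; ring

theorem norm_synth_le (γ : Fin 2 → ℂ) (a : TorusSeq) (z : ℂ) : ‖synth γ a z‖ ≤ ‖a‖ := by
  rw [← synthCLM_apply]
  refine ((synthCLM γ z).le_opNorm a).trans ?_
  have := norm_lpLift_le (fun n => character γ n z / weight γ n) 1 fun n => by
    rw [norm_div, norm_character, div_le_one (norm_pos_iff.2 (weight_ne_zero γ n))]
    exact one_le_norm_weight γ n
  exact mul_le_of_le_one_left (norm_nonneg _) this

theorem norm_synthDel_le (γ : Fin 2 → ℂ) (a : TorusSeq) : ∃ C, ∀ z, ‖synthDel γ a z‖ ≤ C :=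
  ⟨_, norm_trigSeries_le γ (summable_freq_div_weight γ a)⟩

/-- The product of functions on the torus, on the level of coefficients. -/
noncomputable def torusMul (γ : Fin 2 → ℂ) : TorusSeq →L[ℂ] TorusSeq →L[ℂ] TorusSeq :=
  lpLift (fun n => lpLift (fun m => (weight γ (n + m) / (weight γ n * weight γ m)) •
    torusSingle (n + m)) 1 fun m => by
      rw [norm_smul, norm_torusSingle, mul_one]; exact norm_weight_add_le γ n m) 1
    fun n => norm_lpLift_le _ _ _

/-- Both sides are continuous and bilinear, so it suffices to compare them on pairs of characters.
-/
theorem synth_torusMul (γ : Fin 2 → ℂ) (a b : TorusSeq) (z : ℂ) :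
    synth γ (torusMul γ a b) z = synth γ a z * synth γ b z := by
  simp only [← synthCLM_apply]
  have hsingle : ∀ n, synthCLM γ z (torusSingle n) = character γ n z / weight γ n := fun n =>
    lpLift_single _ _ _ n
  have h : (ContinuousLinearMap.compL ℂ TorusSeq TorusSeq ℂ (synthCLM γ z)).comp (torusMul γ)
      = (ContinuousLinearMap.mul ℂ ℂ).bilinearComp (synthCLM γ z) (synthCLM γ z) := by
    refine torusSeq_clm_ext fun n => torusSeq_clm_ext fun m => ?_
    simp only [ContinuousLinearMap.comp_apply, ContinuousLinearMap.compL_apply, torusMul,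
      lpLift_single, map_smul, hsingle, ContinuousLinearMap.bilinearComp_apply,
      ContinuousLinearMap.mul_apply', smul_eq_mul, character_add_index]
    field_simp [weight_ne_zero γ n, weight_ne_zero γ m, weight_ne_zero γ (n + m)]
  exact congrArg (fun L => L a b) h

/-- The zeroth Fourier coefficient. -/
noncomputable def torusMean : TorusSeq →L[ℂ] ℂ :=
  lpLift (fun n => if n = 0 then 1 else 0) 1 fun n => by split_ifs <;> simp

theorem torusMean_apply (a : TorusSeq) : torusMean a = a 0 := by
  rw [torusMean, lpLift_apply, tsum_eq_single 0]
  · simp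
  · intro n hn; simp [hn]

theorem synth_torusSingle_zero (γ : Fin 2 → ℂ) (z : ℂ) : synth γ (torusSingle 0) z = 1 := by
  rw [← synthCLM_apply, synthCLM, lpLift_single]; simp

theorem torusMean_torusSingle_zero : torusMean (torusSingle 0) = 1 := by
  rw [torusMean, lpLift_single]; simp

theorem exists_norm_inv_freq_le {γ : Fin 2 → ℂ} (hγ : LinearIndependent ℝ γ) :
    ∃ C : ℝ, ∀ n, ‖(-conj (freq γ n))⁻¹ • torusSingle n‖ ≤ C := by
  obtain ⟨C, hC, h⟩ := exists_freq_lower_bound hγ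
  refine ⟨C, fun n => ?_⟩
  rw [norm_smul, norm_torusSingle, mul_one, norm_inv, norm_neg, RCLike.norm_conj]
  by_cases hn : n = 0
  -- For `n = 0` the frequency vanishes and `0⁻¹ = 0`: the operator to be built kills constants.
  · simp [hn, hC.le]
  · have h1 := h n hn
    have h2 : 0 < ‖freq γ n‖ := by
      by_contra h0
      have : ‖freq γ n‖ = 0 := le_antisymm (not_lt.1 h0) (norm_nonneg _)
      rw [this] at h1; linarith
    rw [inv_le_iff_one_le_mul₀ h2]
    exact h1

/-- The inverse of `∂̄` on functions of mean zero on the torus. -/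
noncomputable def delbarInv {γ : Fin 2 → ℂ} (hγ : LinearIndependent ℝ γ) :
    TorusSeq →L[ℂ] TorusSeq :=
  lpLift (fun n => (-conj (freq γ n))⁻¹ • torusSingle n) _ (exists_norm_inv_freq_le hγ).choose_spec

theorem delbarInv_apply {γ : Fin 2 → ℂ} (hγ : LinearIndependent ℝ γ) (a : TorusSeq)
    (n : Fin 2 → ℤ) : delbarInv hγ a n = (-conj (freq γ n))⁻¹ * a n := by
  set L : TorusSeq →L[ℂ] ℂ := lp.evalCLM ℂ (fun _ => ℂ) 1 n with hLdef
  have hL : ∀ a, L a = a n := fun a => rfl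
  have h : L.comp (delbarInv hγ) = (-conj (freq γ n))⁻¹ • L := by
    refine torusSeq_clm_ext fun m => ?_
    rw [ContinuousLinearMap.comp_apply, delbarInv, lpLift_single, map_smul, smul_apply, hL,
      torusSingle_apply, smul_eq_mul, smul_eq_mul]
    split_ifs with hnm
    · rw [hnm]
    · simp
  have := congrArg (fun M => M a) h
  simpa [hL] using this

theorem torusMean_delbarInv {γ : Fin 2 → ℂ} (hγ : LinearIndependent ℝ γ) (a : TorusSeq) :
    torusMean (delbarInv hγ a) = 0 := by
  rw [torusMean_apply, delbarInv_apply]; simp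

/-- Multiplying by `-conj (freq γ n)` undoes the inverse at every index except 0, where the
coefficient is lost; hence the mean is subtracted. -/
theorem synthDelbar_delbarInv {γ : Fin 2 → ℂ} (hγ : LinearIndependent ℝ γ) (a : TorusSeq)
    (z : ℂ) : synthDelbar γ (delbarInv hγ a) z = synth γ a z - torusMean a := by
  obtain ⟨C, hC, h⟩ := exists_freq_lower_bound hγ
  have hs := summable_trig γ (summable_div_weight γ a) z
  rw [synth, trigSeries, hs.tsum_eq_add_tsum_ite 0, torusMean_apply, synthDelbar, trigSeries]
  simp only [weight_zero, div_one, character_zero_index, mul_one, add_sub_cancel_left]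
  congr 1
  ext n
  split_ifs with hn
  · simp [hn]
  · have h1 := h n hn
    have h2 : conj (freq γ n) ≠ 0 := by
      intro h0
      rw [map_eq_zero] at h0
      rw [h0, norm_zero, mul_zero] at h1; linarith
    rw [delbarInv_apply]
    field_simp

/-! ### Fourier series of smooth doubly periodic functions -/

/-- The point of the plane with the given real coordinates with respect to the periods. -/
noncomputable def periodComb (γ : Fin 2 → ℂ) (x : Fin 2 → ℝ) : ℂ := x 0 * γ 0 + x 1 * γ 1

theorem exists_periodComb_eq {γ : Fin 2 → ℂ} (hγ : LinearIndependent ℝ γ) (z : ℂ) :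
    ∃ x, periodComb γ x = z := by
  have h := hγ.span_eq_top_of_card_eq_finrank' (by simp [Complex.finrank_real_complex])
  have hz : z ∈ Submodule.span ℝ (Set.range γ) := by rw [h]; trivial
  obtain ⟨x, hx⟩ := (Submodule.mem_span_range_iff_exists_fun ℝ).1 hz
  exact ⟨x, by simpa [periodComb, Fin.sum_univ_two] using hx⟩

theorem character_periodComb {γ : Fin 2 → ℂ} (hγ : LinearIndependent ℝ γ) (n : Fin 2 → ℤ)
    (x : Fin 2 → ℝ) : character γ n (periodComb γ x) =
      Complex.exp (2 * Real.pi * Complex.I * n 0 * x 0) *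
      Complex.exp (2 * Real.pi * Complex.I * n 1 * x 1) := by
  rw [← Complex.exp_add, character, periodComb]
  congr 1
  have h0 := freq_mul_period hγ n 0
  have h1 := freq_mul_period hγ n 1
  simp only [map_add, map_mul, Complex.conj_ofReal]
  linear_combination x 0 * h0 + x 1 * h1

/-- The projection of the plane, in period coordinates, to the torus. -/
noncomputable def torusProj (x : Fin 2 → ℝ) : UnitAddTorus (Fin 2) := fun i => (x i : UnitAddCircle)

theorem isOpenQuotientMap_torusProj : IsOpenQuotientMap torusProj := by
  have : IsOpenQuotientMap (fun x : ℝ => (x : UnitAddCircle)) :=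
    QuotientAddGroup.isOpenQuotientMap_mk
  exact IsOpenQuotientMap.piMap (fun _ : Fin 2 => this)

theorem mFourier_torusProj {γ : Fin 2 → ℂ} (hγ : LinearIndependent ℝ γ) (n : Fin 2 → ℤ)
    (x : Fin 2 → ℝ) : UnitAddTorus.mFourier n (torusProj x) = character γ n (periodComb γ x) := by
  rw [character_periodComb hγ]
  simp [UnitAddTorus.mFourier, torusProj, Fin.prod_univ_two]

/-- A function with periods `γ`, as a function on the standard torus. -/
noncomputable def torusLift (γ : Fin 2 → ℂ) (f : ℂ → ℂ) (t : UnitAddTorus (Fin 2)) : ℂ :=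
  f (periodComb γ (Function.surjInv isOpenQuotientMap_torusProj.surjective t))

theorem periodic_int_comb {γ : Fin 2 → ℂ} {f : ℂ → ℂ} (hf : ∀ k z, f (z + γ k) = f z)
    (m₀ m₁ : ℤ) (z : ℂ) : f (z + (m₀ * γ 0 + m₁ * γ 1)) = f z := by
  have h0 : Function.Periodic f (γ 0) := hf 0
  have h1 : Function.Periodic f (γ 1) := hf 1
  rw [← add_assoc, h1.int_mul m₁, h0.int_mul m₀]

/-- The chosen preimage differs from `x` by an integer vector, hence the corresponding points of the
plane differ by a period. -/
theorem torusLift_torusProj {γ : Fin 2 → ℂ} {f : ℂ → ℂ} (hf : ∀ k z, f (z + γ k) = f z)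
    (x : Fin 2 → ℝ) : torusLift γ f (torusProj x) = f (periodComb γ x) := by
  set y := Function.surjInv isOpenQuotientMap_torusProj.surjective (torusProj x) with hy
  have h : torusProj y = torusProj x := Function.surjInv_eq _ _
  have hm : ∀ i, ∃ m : ℤ, y i = x i + m := by
    intro i
    have hi : ((y i : ℝ) : UnitAddCircle) = (x i : UnitAddCircle) := congrFun h i
    obtain ⟨m, hm⟩ := QuotientAddGroup.eq.1 hi.symm
    refine ⟨m, ?_⟩
    simp only [zsmul_eq_mul, mul_one] at hm
    linarith
  obtain ⟨m₀, h0⟩ := hm 0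
  obtain ⟨m₁, h1⟩ := hm 1
  have hc : periodComb γ y = periodComb γ x + (m₀ * γ 0 + m₁ * γ 1) := by
    simp only [periodComb, h0, h1]
    push_cast
    ring
  rw [torusLift, ← hy, hc, periodic_int_comb hf]

theorem continuous_torusLift {γ : Fin 2 → ℂ} {f : ℂ → ℂ} (hf : ∀ k z, f (z + γ k) = f z)
    (hc : Continuous f) : Continuous (torusLift γ f) := by
  rw [isOpenQuotientMap_torusProj.isQuotientMap.continuous_iff]
  have : torusLift γ f ∘ torusProj = fun x => f (periodComb γ x) :=
    funext fun x => torusLift_torusProj hf x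
  rw [this]
  unfold periodComb
  fun_prop

/-- The derivative of `f` along the `k`-th period. -/
noncomputable def periodDeriv (γ : Fin 2 → ℂ) (k : Fin 2) (f : ℂ → ℂ) (z : ℂ) : ℂ :=
  fderiv ℝ f z (γ k)

theorem periodic_fderiv {f : ℂ → ℂ} {c : ℂ} (hf : ∀ z, f (z + c) = f z) (z : ℂ) :
    fderiv ℝ f (z + c) = fderiv ℝ f z := by
  rw [← fderiv_comp_add_right]
  congr 1
  exact funext hf

theorem periodic_periodDeriv {γ : Fin 2 → ℂ} {f : ℂ → ℂ} (hf : ∀ k z, f (z + γ k) = f z)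
    (j k : Fin 2) (z : ℂ) : periodDeriv γ j f (z + γ k) = periodDeriv γ j f z := by
  rw [periodDeriv, periodic_fderiv (hf k), periodDeriv]

theorem contDiff_periodDeriv {f : ℂ → ℂ} (γ : Fin 2 → ℂ) (k : Fin 2) (hf : ContDiff ℝ ∞ f) :
    ContDiff ℝ ∞ (periodDeriv γ k f) :=
  (hf.fderiv_right (m := ∞) (by norm_cast)).clm_apply contDiff_const

theorem bounded_torusLift {γ : Fin 2 → ℂ} {f : ℂ → ℂ} (hf : ∀ k z, f (z + γ k) = f z)
    (hc : Continuous f) : ∃ C, ∀ t, ‖torusLift γ f t‖ ≤ C := by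
  obtain ⟨C, hC⟩ := isCompact_univ.exists_bound_of_continuousOn
    (continuous_torusLift hf hc).continuousOn
  exact ⟨C, fun t => hC t trivial⟩

open MeasureTheory UnitAddTorus

/-- The normalized Haar measure of the torus. -/
noncomputable abbrev torusMeasure : Measure (UnitAddTorus (Fin 2)) :=
  Measure.pi fun _ => AddCircle.haarAddCircle

theorem mFourierCoeff_eq (F : UnitAddTorus (Fin 2) → ℂ) (n : Fin 2 → ℤ) :
    mFourierCoeff F n = ∫ t, mFourier (-n) t * F t ∂torusMeasure := rfl

theorem norm_mFourier_apply_le (n : Fin 2 → ℤ) (t : UnitAddTorus (Fin 2)) :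
    ‖mFourier n t‖ ≤ 1 :=
  (ContinuousMap.norm_coe_le_norm _ _).trans_eq mFourier_norm

theorem integrable_of_continuous_torus {f : UnitAddTorus (Fin 2) → ℂ} (hf : Continuous f) :
    Integrable f torusMeasure :=
  hf.integrable_of_hasCompactSupport (HasCompactSupport.of_compactSpace f)

/-- Translation invariance of Haar measure. Differentiating this in `h` replaces integration by
parts on the torus. -/
theorem mFourierCoeff_shift (F : UnitAddTorus (Fin 2) → ℂ) (n : Fin 2 → ℤ)
    (h : UnitAddTorus (Fin 2)) :
    ∫ t, mFourier (-n) t * F (t + h) ∂torusMeasure = mFourier n h * mFourierCoeff F n := by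
  have h1 := integral_add_right_eq_self (μ := torusMeasure)
    (fun t => mFourier (-n) (t - h) * F t) h
  simp only [add_sub_cancel_right] at h1
  rw [h1, mFourierCoeff_eq, ← integral_const_mul]
  apply integral_congr_ae
  refine Filter.Eventually.of_forall fun t => ?_
  have h2 : mFourier (-n) (t - h) = mFourier n h * mFourier (-n) t := by
    simp only [mFourier, ContinuousMap.coe_mk, Fin.prod_univ_two, Pi.neg_apply, Pi.sub_apply]
    simp only [fourier_apply, smul_sub, neg_smul, sub_neg_eq_add, AddCircle.toCircle_add,
      Circle.coe_mul]
    ring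
  simp only [h2, mul_assoc]

theorem mFourierCoeff_periodDeriv {γ : Fin 2 → ℂ} {f : ℂ → ℂ}
    (hf : ∀ k z, f (z + γ k) = f z) (hc : ContDiff ℝ ∞ f) (k : Fin 2) (n : Fin 2 → ℤ) :
    mFourierCoeff (torusLift γ (periodDeriv γ k f)) n =
      2 * Real.pi * Complex.I * n k * mFourierCoeff (torusLift γ f) n := by
  set e : ℝ → UnitAddTorus (Fin 2) := fun s => torusProj (Pi.single k s) with he
  have hadd : ∀ x s, torusProj x + e s = torusProj (x + Pi.single k s) := fun x s => by
    ext i; simp [he, torusProj]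
  have hcomb : ∀ x s, periodComb γ (x + Pi.single k s) = periodComb γ x + s * γ k := fun x s => by
    fin_cases k
    · simp [periodComb]; ring
    · simp [periodComb]; ring
  have hc' := contDiff_periodDeriv γ k hc
  have hcont := continuous_torusLift hf hc.continuous
  have hcont' := continuous_torusLift (periodic_periodDeriv hf k) hc'.continuous
  obtain ⟨C, hC⟩ := bounded_torusLift (periodic_periodDeriv hf k) hc'.continuous
  have hdiff : ∀ t s, HasDerivAt (fun s => mFourier (-n) t * torusLift γ f (t + e s))
      (mFourier (-n) t * torusLift γ (periodDeriv γ k f) (t + e s)) s := by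
    intro t s
    obtain ⟨x, rfl⟩ := isOpenQuotientMap_torusProj.surjective t
    simp only [hadd, torusLift_torusProj hf, torusLift_torusProj (periodic_periodDeriv hf k),
      hcomb]
    refine HasDerivAt.const_mul _ ?_
    have h1 := ((hc.differentiable (by simp)) (periodComb γ x + s * γ k)).hasFDerivAt
    have h2 : HasDerivAt (fun s : ℝ => periodComb γ x + (s : ℂ) * γ k) (γ k) s := by
      simpa using ((Complex.ofRealCLM.hasDerivAt (x := s)).mul_const (γ k)).const_add
        (periodComb γ x)
    exact h1.comp_hasDerivAt s h2
  -- Both sides of the shift formula along the one-parameter subgroup `e` are differentiated at `0`: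
  -- the integral under the integral sign, the character explicitly.
  have key := hasDerivAt_integral_of_dominated_loc_of_deriv_le (μ := torusMeasure)
    (F := fun s t => mFourier (-n) t * torusLift γ f (t + e s))
    (F' := fun s t => mFourier (-n) t * torusLift γ (periodDeriv γ k f) (t + e s))
    (x₀ := (0 : ℝ)) (s := Set.univ) (bound := fun _ => C) Filter.univ_mem
    (Filter.Eventually.of_forall fun s => by
      exact ((mFourier (-n)).continuous.mul
        (hcont.comp (continuous_id.add continuous_const))).aestronglyMeasurable)
    (integrable_of_continuous_torus ((mFourier (-n)).continuous.mul
        (hcont.comp (continuous_id.add continuous_const))))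
    ((mFourier (-n)).continuous.mul
        (hcont'.comp (continuous_id.add continuous_const))).aestronglyMeasurable
    (Filter.Eventually.of_forall fun t s _ => by
      rw [norm_mul]
      have := mul_le_mul (norm_mFourier_apply_le (-n) t) (hC (t + e s)) (norm_nonneg _) zero_le_one
      simpa using this)
    (integrable_const C)
    (Filter.Eventually.of_forall fun t s _ => hdiff t s)
  have h1 := key.2
  simp only [mFourierCoeff_shift] at h1
  have he0 : mFourier n (e 0) = 1 := by
    simp [he, mFourier, torusProj, Fin.prod_univ_two]
  have hexp : ∀ s, mFourier n (e s) = Complex.exp (2 * Real.pi * Complex.I * n k * s) := by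
    intro s
    fin_cases k
    · simp [he, mFourier, torusProj, Fin.prod_univ_two]
    · simp [he, mFourier, torusProj, Fin.prod_univ_two]
  rw [he0, one_mul] at h1
  have h2 : HasDerivAt (fun s : ℝ => mFourier n (e s) * mFourierCoeff (torusLift γ f) n)
      (2 * Real.pi * Complex.I * n k * mFourierCoeff (torusLift γ f) n) 0 := by
    simp only [hexp]
    have h3 := (Complex.ofRealCLM.hasDerivAt (x := (0 : ℝ))).const_mul
      (2 * Real.pi * Complex.I * n k)
    have h4 := (h3.cexp).mul_const (mFourierCoeff (torusLift γ f) n)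
    simpa using h4
  exact h1.unique h2

theorem bounded_mFourierCoeff {γ : Fin 2 → ℂ} {f : ℂ → ℂ}
    (hf : ∀ k z, f (z + γ k) = f z) (hc : Continuous f) :
    ∃ C, ∀ n, ‖mFourierCoeff (torusLift γ f) n‖ ≤ C := by
  obtain ⟨C, hC⟩ := bounded_torusLift hf hc
  refine ⟨∫ _ : UnitAddTorus (Fin 2), C ∂torusMeasure, fun n => ?_⟩
  rw [mFourierCoeff_eq]
  apply norm_integral_le_of_norm_le
    (integrable_const (μ := torusMeasure) C)
  refine Filter.Eventually.of_forall fun t => ?_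
  rw [norm_mul]
  have := mul_le_mul (norm_mFourier_apply_le (-n) t) (hC t) (norm_nonneg _) zero_le_one
  simpa using this

theorem summable_inv_one_add_int_sq : Summable fun n : ℤ => (1 + (n : ℝ) ^ 2)⁻¹ := by
  have h1 : Summable fun n : ℤ => 1 / (n : ℝ) ^ 2 + if n = 0 then (1 : ℝ) else 0 :=
    (Real.summable_one_div_int_pow.2 (by norm_num)).add
      (hasSum_ite_eq (0 : ℤ) (1 : ℝ)).summable
  refine Summable.of_nonneg_of_le (fun n => by positivity) (fun n => ?_) h1
  by_cases hn : n = 0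
  · simp [hn]
  · have : (0 : ℝ) < (n : ℝ) ^ 2 := by positivity
    simp only [hn, if_false, add_zero, one_div]
    exact inv_anti₀ this (by linarith)

theorem summable_inv_one_add_int_sq_pair :
    Summable fun n : Fin 2 → ℤ => ((1 + (n 0 : ℝ) ^ 2) * (1 + (n 1 : ℝ) ^ 2))⁻¹ := by
  have h := summable_inv_one_add_int_sq.mul_of_nonneg summable_inv_one_add_int_sq
    (fun n => by positivity) (fun n => by positivity)
  have := (finTwoArrowEquiv ℤ).summable_iff.2 h
  refine this.congr fun n => ?_
  simp [finTwoArrowEquiv, mul_comm]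

open UnitAddTorus

section decay
variable {γ : Fin 2 → ℂ} {f : ℂ → ℂ}

theorem norm_mFourierCoeff_periodDeriv_twice (hf : ∀ k z, f (z + γ k) = f z)
    (hc : ContDiff ℝ ∞ f) (k : Fin 2) (n : Fin 2 → ℤ) :
    (n k : ℝ) ^ 2 * ‖mFourierCoeff (torusLift γ f) n‖ ≤
      ‖mFourierCoeff (torusLift γ (periodDeriv γ k (periodDeriv γ k f))) n‖ := by
  rw [mFourierCoeff_periodDeriv (periodic_periodDeriv hf k) (contDiff_periodDeriv γ k hc),
    mFourierCoeff_periodDeriv hf hc]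
  simp only [norm_mul, Complex.norm_ofNat, Complex.norm_real, Real.norm_eq_abs, Complex.norm_I,
    mul_one, Complex.norm_intCast, abs_of_pos Real.pi_pos]
  have h1 : (1 : ℝ) ≤ 2 * Real.pi := by have := Real.pi_gt_three; linarith
  have h2 := sq_abs (n k : ℝ)
  have h3 : (1 : ℝ) ≤ (2 * Real.pi) ^ 2 := one_le_pow₀ h1
  have h4 : 0 ≤ (n k : ℝ) ^ 2 * ‖mFourierCoeff (torusLift γ f) n‖ := by positivity
  calc (n k : ℝ) ^ 2 * ‖mFourierCoeff (torusLift γ f) n‖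
      ≤ (2 * Real.pi) ^ 2 * ((n k : ℝ) ^ 2 * ‖mFourierCoeff (torusLift γ f) n‖) :=
        le_mul_of_one_le_left h4 h3
    _ = _ := by rw [← h2]; ring

/-- Expanding the product of weights gives four terms, which are bounded by the coefficients of `f`,
of its two second derivatives along the periods, and of the mixed fourth derivative. Keeping the
functions `F i` instead of constants allows the bound to be used twice: with bounded coefficients
for summability, with summable ones for weighted summability. -/
theorem exists_decay_bound (hf : ∀ k z, f (z + γ k) = f z) (hc : ContDiff ℝ ∞ f) :
    ∃ F : Fin 4 → ℂ → ℂ, (∀ i, (∀ k z, F i (z + γ k) = F i z) ∧ ContDiff ℝ ∞ (F i)) ∧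
      ∀ n : Fin 2 → ℤ, (1 + (n 0 : ℝ) ^ 2) * (1 + (n 1 : ℝ) ^ 2) *
        ‖mFourierCoeff (torusLift γ f) n‖ ≤ ∑ i, ‖mFourierCoeff (torusLift γ (F i)) n‖ := by
  have hp : ∀ (k : Fin 2) {g : ℂ → ℂ}, (∀ k z, g (z + γ k) = g z) → ContDiff ℝ ∞ g →
      (∀ j z, periodDeriv γ k (periodDeriv γ k g) (z + γ j) =
        periodDeriv γ k (periodDeriv γ k g) z) ∧
      ContDiff ℝ ∞ (periodDeriv γ k (periodDeriv γ k g)) := fun k g hg hgc =>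
    ⟨periodic_periodDeriv (periodic_periodDeriv hg k) k,
      contDiff_periodDeriv γ k (contDiff_periodDeriv γ k hgc)⟩
  set g := periodDeriv γ 0 (periodDeriv γ 0 f)
  have hg := hp 0 hf hc
  have hf1 := hp 1 hf hc
  have hg1 := hp 1 hg.1 hg.2
  refine ⟨![f, g, periodDeriv γ 1 (periodDeriv γ 1 f), periodDeriv γ 1 (periodDeriv γ 1 g)],
    ?_, fun n => ?_⟩
  · intro i
    fin_cases i
    · exact ⟨hf, hc⟩
    · exact hg
    · exact hf1
    · exact hg1
  · have e1 := norm_mFourierCoeff_periodDeriv_twice hf hc 0 n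
    have e2 := norm_mFourierCoeff_periodDeriv_twice hf hc 1 n
    have e3 := norm_mFourierCoeff_periodDeriv_twice hg.1 hg.2 1 n
    have e4 := mul_le_mul_of_nonneg_left e1 (sq_nonneg (n 1 : ℝ))
    simp only [Fin.sum_univ_four, Matrix.cons_val]
    linarith

theorem summable_mFourierCoeff (hf : ∀ k z, f (z + γ k) = f z) (hc : ContDiff ℝ ∞ f) :
    Summable (mFourierCoeff (torusLift γ f)) := by
  obtain ⟨F, hF, hb⟩ := exists_decay_bound hf hc
  choose C hC using fun i => bounded_mFourierCoeff (hF i).1 (hF i).2.continuous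
  refine Summable.of_norm_bounded (summable_inv_one_add_int_sq_pair.mul_left (∑ i, C i))
    fun n => ?_
  rw [← div_eq_mul_inv, le_div_iff₀ (by positivity), mul_comm]
  exact (hb n).trans (Finset.sum_le_sum fun i _ => hC i n)

theorem exists_norm_freq_le (γ : Fin 2 → ℂ) :
    ∃ M : ℝ, 0 ≤ M ∧ ∀ n, ‖freq γ n‖ ≤ M * (|(n 0 : ℝ)| + |(n 1 : ℝ)|) := by
  refine ⟨2 * Real.pi * (‖γ 0‖ + ‖γ 1‖) / ‖periodDet γ‖, by positivity, fun n => ?_⟩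
  rw [freq, norm_div, div_mul_eq_mul_div]
  gcongr
  rw [norm_mul]
  simp only [norm_mul, Complex.norm_ofNat, Complex.norm_real, Real.norm_eq_abs, Complex.norm_I,
    mul_one, abs_of_pos Real.pi_pos]
  rw [mul_assoc (2 * Real.pi)]
  gcongr
  refine (norm_sub_le _ _).trans ?_
  simp only [norm_mul, Complex.norm_intCast, RCLike.norm_conj]
  nlinarith [norm_nonneg (γ 0), norm_nonneg (γ 1), abs_nonneg (n 0 : ℝ), abs_nonneg (n 1 : ℝ)]

/-- Compares the weight, quadratic in `n`, with the product that controls the decay of Fourier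
coefficients. -/
theorem exists_norm_weight_le (γ : Fin 2 → ℂ) :
    ∃ K : ℝ, 0 ≤ K ∧ ∀ n, ‖weight γ n‖ ≤ K * ((1 + (n 0 : ℝ) ^ 2) * (1 + (n 1 : ℝ) ^ 2)) := by
  obtain ⟨M, hM, h⟩ := exists_norm_freq_le γ
  refine ⟨3 * (1 + M ^ 2), by positivity, fun n => ?_⟩
  rw [norm_weight]
  set x := |(n 0 : ℝ)|
  set y := |(n 1 : ℝ)|
  have hx : (n 0 : ℝ) ^ 2 = x ^ 2 := (sq_abs _).symm
  have hy : (n 1 : ℝ) ^ 2 = y ^ 2 := (sq_abs _).symm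
  rw [hx, hy]
  calc (1 + ‖freq γ n‖) ^ 2 ≤ (1 + M * (x + y)) ^ 2 := by gcongr; exact h n
    _ ≤ 3 * (1 + (M * x) ^ 2 + (M * y) ^ 2) := by
      nlinarith [sq_nonneg (1 - M * x), sq_nonneg (1 - M * y), sq_nonneg (M * x - M * y)]
    _ ≤ 3 * (1 + M ^ 2) * ((1 + x ^ 2) * (1 + y ^ 2)) := by
      have : 0 ≤ x ^ 2 * y ^ 2 := by positivity
      nlinarith [sq_nonneg M, sq_nonneg x, sq_nonneg y, mul_nonneg (sq_nonneg M) this]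

/-- A smooth function on the torus is represented by a weighted summable Fourier series. -/
theorem exists_synth_eq (hγ : LinearIndependent ℝ γ) (hf : ∀ k z, f (z + γ k) = f z)
    (hc : ContDiff ℝ ∞ f) : ∃ a : TorusSeq, ∀ z, synth γ a z = f z := by
  obtain ⟨F, hF, hb⟩ := exists_decay_bound hf hc
  obtain ⟨K, hK, hw⟩ := exists_norm_weight_le γ
  -- The decay bound absorbs the weight, and the coefficients of each `F i` are themselves summable
  -- because `F i` is again smooth and periodic.
  have hs : Summable fun n => ‖weight γ n * mFourierCoeff (torusLift γ f) n‖ := by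
    have h1 : Summable fun n => K * ∑ i, ‖mFourierCoeff (torusLift γ (F i)) n‖ :=
      (summable_sum fun i _ => (summable_mFourierCoeff (hF i).1 (hF i).2).norm).mul_left K
    refine Summable.of_nonneg_of_le (fun n => norm_nonneg _) (fun n => ?_) h1
    rw [norm_mul]
    calc _ ≤ K * ((1 + (n 0 : ℝ) ^ 2) * (1 + (n 1 : ℝ) ^ 2)) *
          ‖mFourierCoeff (torusLift γ f) n‖ := by gcongr; exact hw n
      _ ≤ _ := by rw [mul_assoc]; exact mul_le_mul_of_nonneg_left (hb n) hK
  refine ⟨⟨fun n => weight γ n * mFourierCoeff (torusLift γ f) n,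
    (memℓp_gen_iff (by simp)).2 (by simpa using hs)⟩, fun z => ?_⟩
  obtain ⟨x, rfl⟩ := exists_periodComb_eq hγ z
  have h := hasSum_mFourier_series_apply_of_summable
    (f := ⟨torusLift γ f, continuous_torusLift hf hc.continuous⟩)
    (summable_mFourierCoeff hf hc) (torusProj x)
  simp only [ContinuousMap.coe_mk, torusLift_torusProj hf, mFourier_torusProj hγ, smul_eq_mul] at h
  rw [← h.tsum_eq, synth, trigSeries]
  congr 1
  ext n
  rw [mul_div_cancel_left₀ _ (weight_ne_zero γ n)]

end decay

/-! ### Averages over the period parallelogram -/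

open MeasureTheory

/-- The real-linear map of the plane that carries the unit square to the period parallelogram. -/
noncomputable def periodMap (γ : Fin 2 → ℂ) : ℂ →L[ℝ] ℂ :=
  Complex.reCLM.smulRight (γ 0) + Complex.imCLM.smulRight (γ 1)

theorem periodMap_apply (γ : Fin 2 → ℂ) (z : ℂ) :
    periodMap γ z = z.re * γ 0 + z.im * γ 1 := by
  simp [periodMap]

theorem periodMap_injective {γ : Fin 2 → ℂ} (hγ : LinearIndependent ℝ γ) :
    Function.Injective (periodMap γ) := by
  refine (injective_iff_map_eq_zero _).2 fun z hz => ?_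
  rw [periodMap_apply] at hz
  have := Fintype.linearIndependent_iff.1 hγ ![z.re, z.im]
    (by simpa [Fin.sum_univ_two] using hz)
  exact Complex.ext (by simpa using this 0) (by simpa using this 1)

theorem det_periodMap_ne_zero {γ : Fin 2 → ℂ} (hγ : LinearIndependent ℝ γ) :
    (periodMap γ).det ≠ 0 := by
  intro h
  have h1 := LinearMap.bot_lt_ker_of_det_eq_zero (f := (periodMap γ : ℂ →ₗ[ℝ] ℂ)) h
  have h2 : LinearMap.ker (periodMap γ : ℂ →ₗ[ℝ] ℂ) = ⊥ :=
    LinearMap.ker_eq_bot.2 (periodMap_injective hγ)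
  rw [h2] at h1
  exact lt_irrefl _ h1

/-- The half-open unit square. -/
noncomputable def unitSquare : Set ℂ := Set.Ico (0 : ℝ) 1 ×ℂ Set.Ico (0 : ℝ) 1

theorem measurableSet_unitSquare : MeasurableSet unitSquare :=
  (measurableSet_Ico.preimage Complex.measurable_re).inter
    (measurableSet_Ico.preimage Complex.measurable_im)

theorem parallelogram_eq_image (γ : Fin 2 → ℂ) :
    parallelogram γ = periodMap γ '' unitSquare := by
  ext z
  constructor
  · rintro ⟨s, hs, t, ht, rfl⟩
    refine ⟨⟨s, t⟩, ⟨hs, ht⟩, ?_⟩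
    rw [periodMap_apply]
  · rintro ⟨w, ⟨hs, ht⟩, rfl⟩
    exact ⟨w.re, hs, w.im, ht, periodMap_apply γ w⟩

theorem setIntegral_unitSquare (g : ℝ × ℝ → ℂ) :
    ∫ z in unitSquare, g (z.re, z.im) = ∫ p in Set.Ico (0 : ℝ) 1 ×ˢ Set.Ico (0 : ℝ) 1, g p := by
  have h := Complex.volume_preserving_equiv_real_prod.setIntegral_preimage_emb
    Complex.measurableEquivRealProd.measurableEmbedding g
    (Set.Ico (0 : ℝ) 1 ×ˢ Set.Ico (0 : ℝ) 1)
  have hs : Complex.measurableEquivRealProd ⁻¹' (Set.Ico (0 : ℝ) 1 ×ˢ Set.Ico (0 : ℝ) 1) =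
      unitSquare := by
    ext z
    simp [unitSquare, Complex.mem_reProdIm, Complex.measurableEquivRealProd_apply]
  rw [hs] at h
  exact h

theorem setIntegral_parallelogram {γ : Fin 2 → ℂ} (hγ : LinearIndependent ℝ γ) (g : ℂ → ℂ) :
    ∫ z in parallelogram γ, g z = |(periodMap γ).det| • ∫ z in unitSquare, g (periodMap γ z) := by
  rw [parallelogram_eq_image, integral_image_eq_integral_abs_det_fderiv_smul volume
    measurableSet_unitSquare (fun x _ => (periodMap γ).hasFDerivAt.hasFDerivWithinAt)
    (periodMap_injective hγ).injOn, integral_smul]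

/-- Under the change of variables to the unit square, the constant Jacobian cancels against the area
of the parallelogram. -/
theorem torusAverage_eq {γ : Fin 2 → ℂ} (hγ : LinearIndependent ℝ γ) (g : ℂ → ℂ) :
    torusAverage γ g = ∫ z in unitSquare, g (periodMap γ z) := by
  have hd : (|(periodMap γ).det| : ℝ) ≠ 0 := abs_ne_zero.2 (det_periodMap_ne_zero hγ)
  have h1 := setIntegral_parallelogram hγ (fun _ => 1)
  have h2 := setIntegral_unitSquare (fun _ => 1)
  simp only [setIntegral_const] at h1 h2
  have h3 : (volume : Measure (ℝ × ℝ)).real (Set.Ico (0 : ℝ) 1 ×ˢ Set.Ico (0 : ℝ) 1) = 1 := by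
    rw [Measure.real, Measure.volume_eq_prod, Measure.prod_prod]; simp
  rw [h3] at h2
  rw [h2] at h1
  have h4 : volume.real (parallelogram γ) = |(periodMap γ).det| := by
    have := congrArg Complex.re h1
    simpa using this
  rw [torusAverage, setAverage_eq, h4, setIntegral_parallelogram hγ, smul_smul,
    inv_mul_cancel₀ hd, one_smul]

theorem integral_Ico_exp (n : ℤ) :
    ∫ x in Set.Ico (0 : ℝ) 1, Complex.exp (2 * Real.pi * Complex.I * n * x) =
      if n = 0 then 1 else 0 := by
  rw [integral_Ico_eq_integral_Ioc, ← intervalIntegral.integral_of_le zero_le_one]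
  split_ifs with hn
  · simp [hn]
  · have hc : 2 * Real.pi * Complex.I * (n : ℂ) ≠ 0 := by
      simp [hn, Real.pi_ne_zero]
    rw [integral_exp_mul_complex hc]
    have h1 : Complex.exp (2 * Real.pi * Complex.I * n * (1 : ℝ)) = 1 := by
      rw [Complex.ofReal_one, mul_one, mul_comm, Complex.exp_int_mul_two_pi_mul_I]
    rw [h1]; simp

theorem integral_unitSquare_character {γ : Fin 2 → ℂ} (hγ : LinearIndependent ℝ γ)
    (n : Fin 2 → ℤ) :
    ∫ z in unitSquare, character γ n (periodMap γ z) = if n = 0 then 1 else 0 := by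
  let g : ℝ × ℝ → ℂ := fun p => Complex.exp (2 * Real.pi * Complex.I * n 0 * p.1) *
    Complex.exp (2 * Real.pi * Complex.I * n 1 * p.2)
  have h : ∀ z : ℂ, character γ n (periodMap γ z) = g (z.re, z.im) := fun z => by
    have := character_periodComb hγ n ![z.re, z.im]
    simpa [periodComb, periodMap_apply, g] using this
  rw [integral_congr_ae (Filter.Eventually.of_forall h), setIntegral_unitSquare g, Measure.volume_eq_prod,
    setIntegral_prod_mul (fun x : ℝ => Complex.exp (2 * Real.pi * Complex.I * n 0 * x))
      (fun x : ℝ => Complex.exp (2 * Real.pi * Complex.I * n 1 * x)),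
    integral_Ico_exp, integral_Ico_exp]
  by_cases h0 : n 0 = 0
  · by_cases h1 : n 1 = 0
    · have : n = 0 := by ext i; fin_cases i <;> simp [h0, h1]
      simp [this]
    · have : n ≠ 0 := fun hn => h1 (by simp [hn])
      simp [this, h1]
  · have : n ≠ 0 := fun hn => h0 (by simp [hn])
    simp [this, h0]

/-- The average of a trigonometric series is its constant coefficient. -/
theorem torusAverage_trigSeries {γ : Fin 2 → ℂ} (hγ : LinearIndependent ℝ γ)
    {c : (Fin 2 → ℤ) → ℂ} (hc : Summable c) : torusAverage γ (trigSeries γ c) = c 0 := by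
  have hcont : ∀ n, Continuous fun z => c n * character γ n (periodMap γ z) := fun n => by
    unfold character
    have := (periodMap γ).continuous
    fun_prop
  have hfin : volume unitSquare < ⊤ := by
    have hb : Bornology.IsBounded unitSquare :=
      (Metric.isBounded_Ico 0 1).reProdIm (Metric.isBounded_Ico 0 1)
    exact hb.measure_lt_top
  have hint : ∀ n, IntegrableOn (fun z => c n * character γ n (periodMap γ z)) unitSquare := by
    intro n
    refine Measure.integrableOn_of_bounded (M := ‖c n‖) hfin.ne
      (hcont n).aestronglyMeasurable (Filter.Eventually.of_forall fun z => ?_)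
    simp
  have hsum : Summable fun n => ∫ z in unitSquare, ‖c n * character γ n (periodMap γ z)‖ := by
    simp only [norm_mul, norm_character, mul_one, setIntegral_const, smul_eq_mul]
    exact hc.norm.mul_left _
  rw [torusAverage_eq hγ]
  simp only [trigSeries]
  rw [← integral_tsum_of_summable_integral_norm hint hsum]
  simp only [integral_const_mul, integral_unitSquare_character hγ]
  rw [tsum_eq_single 0]
  · simp
  · intro n hn; simp [hn]

theorem torusAverage_synth {γ : Fin 2 → ℂ} (hγ : LinearIndependent ℝ γ) (a : TorusSeq) :
    torusAverage γ (synth γ a) = torusMean a := by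
  rw [synth, torusAverage_trigSeries hγ (summable_div_weight γ a), torusMean_apply]; simp

/-- The factor `freq γ 0 = 0` removes the constant term: derivatives of periodic functions have mean
zero. -/
theorem torusAverage_synthDel {γ : Fin 2 → ℂ} (hγ : LinearIndependent ℝ γ) (a : TorusSeq) :
    torusAverage γ (synthDel γ a) = 0 := by
  rw [synthDel, torusAverage_trigSeries hγ (summable_freq_div_weight γ a)]; simp

/-! ### The `∂̄`-Riccati equation by the implicit function theorem -/

/-- A rank one perturbation of the identity is invertible if `1 + l v ≠ 0`. -/
theorem isInvertible_id_add_smulRight {E : Type*} [NormedAddCommGroup E] [NormedSpace ℂ E]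
    (l : E →L[ℂ] ℂ) (v : E) (h : 1 + l v ≠ 0) :
    (ContinuousLinearMap.id ℂ E + l.smulRight v).IsInvertible := by
  -- The inverse is given by the Sherman–Morrison formula.
  refine ⟨ContinuousLinearEquiv.equivOfInverse (ContinuousLinearMap.id ℂ E + l.smulRight v)
    (ContinuousLinearMap.id ℂ E - ((1 + l v)⁻¹ • l).smulRight v) ?_ ?_, ?_⟩
  · intro x
    simp only [add_apply, sub_apply, ContinuousLinearMap.id_apply,
      ContinuousLinearMap.smulRight_apply, smul_apply, map_add, map_smul, smul_eq_mul]
    match_scalars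
    · simp
    · field_simp
      ring
  · intro x
    simp only [add_apply, sub_apply, ContinuousLinearMap.id_apply,
      ContinuousLinearMap.smulRight_apply, smul_apply, map_sub, map_smul, smul_eq_mul]
    match_scalars
    · simp
    · field_simp
      ring
  · rfl

theorem torusMul_torusSingle_zero (γ : Fin 2 → ℂ) (a : TorusSeq) :
    torusMul γ a (torusSingle 0) = a := by
  have h : (torusMul γ).flip (torusSingle 0) = ContinuousLinearMap.id ℂ TorusSeq := by
    refine torusSeq_clm_ext fun n => ?_
    rw [ContinuousLinearMap.flip_apply, torusMul, lpLift_single, lpLift_single, add_zero,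
      weight_zero, mul_one, div_self (weight_ne_zero γ n), one_smul]
    rfl
  exact congrArg (fun L => L a) h

/-- The right-hand side of the `∂̄`-equation for `p`, apart from its term independent of `p`. -/
noncomputable def riccatiRest (γ : Fin 2 → ℂ) (ch sh : TorusSeq) (ζ : ℂ) (p : TorusSeq) :
    TorusSeq :=
  (-Complex.I) • torusMul γ ch p + (Complex.I / 2 * ζ) • torusMul γ sh (torusMul γ p p)

/-- Solvability of the `∂̄`-equation of Riccati type on the torus for a small parameter. -/
theorem exists_riccati_family {γ : Fin 2 → ℂ} (hγ : LinearIndependent ℝ γ)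
    (ch sh p₀ : TorusSeq) (hch : torusMean ch ≠ 0) (h₀ : torusMean p₀ = 0)
    (hc : torusMean (torusMul γ ch p₀) = 0) :
    ∃ P : ℂ → TorusSeq, AnalyticAt ℂ P 0 ∧ P 0 = p₀ ∧ ∀ᶠ ζ in 𝓝 (0 : ℂ),
      torusMean (riccatiRest γ ch sh ζ (P ζ)) = 0 ∧
      P ζ = p₀ + torusMean (P ζ) • torusSingle 0 +
        ζ • delbarInv hγ (riccatiRest γ ch sh ζ (P ζ)) := by
  -- Two equations are added into one: the integrated `∂̄`-equation, whose defect has mean zero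
  -- because `p₀` and the image of `delbarInv` do, and the solvability condition that the rest have
  -- mean zero, which takes values in the constants. The sum vanishes only if both do.
  let Φ : ℂ × TorusSeq → TorusSeq := fun x =>
    x.2 - p₀ - torusMean x.2 • torusSingle 0 - x.1 • delbarInv hγ (riccatiRest γ ch sh x.1 x.2)
      + torusMean (riccatiRest γ ch sh x.1 x.2) • torusSingle 0
  have hrest : ContDiff ℂ ω fun x : ℂ × TorusSeq => riccatiRest γ ch sh x.1 x.2 := by
    unfold riccatiRest
    fun_prop
  have hΦ : ContDiffAt ℂ ω Φ (0, p₀) := by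
    refine ContDiff.contDiffAt ?_
    have h1 : ContDiff ℂ ω fun x : ℂ × TorusSeq => torusMean x.2 := by fun_prop
    have h2 : ContDiff ℂ ω fun x : ℂ × TorusSeq =>
        torusMean (riccatiRest γ ch sh x.1 x.2) := torusMean.contDiff.comp hrest
    have h3 : ContDiff ℂ ω fun x : ℂ × TorusSeq =>
        delbarInv hγ (riccatiRest γ ch sh x.1 x.2) := (delbarInv hγ).contDiff.comp hrest
    exact (((contDiff_snd.sub contDiff_const).sub (h1.smul contDiff_const)).sub
      (contDiff_fst.smul h3)).add (h2.smul contDiff_const)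
  have hΦ0 : Φ (0, p₀) = 0 := by simp [Φ, riccatiRest, h₀, hc]
  -- The partial derivative of `Φ` in `p` at `ζ = 0` is the identity plus the rank one map `q ↦
  -- l(q)·1`. Its only obstruction to invertibility is `1 + l(1) = -i⟨cosh 2u⟩` in the application.
  let l : TorusSeq →L[ℂ] ℂ := -torusMean - Complex.I • (torusMean.comp (torusMul γ ch))
  have hl : 1 + l (torusSingle 0) ≠ 0 := by
    have : 1 + l (torusSingle 0) = -(Complex.I * torusMean ch) := by
      simp [l, torusMean_torusSingle_zero, torusMul_torusSingle_zero]
      ring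
    rw [this]
    simpa using hch
  have hinv : (fderiv ℂ Φ (0, p₀) ∘SL ContinuousLinearMap.inr ℂ ℂ TorusSeq).IsInvertible := by
    have h1 : HasFDerivAt (fun p => Φ (0, p))
        (fderiv ℂ Φ (0, p₀) ∘SL ContinuousLinearMap.inr ℂ ℂ TorusSeq) p₀ :=
      (hΦ.differentiableAt (by simp)).hasFDerivAt.comp (f := fun p => ((0 : ℂ), p)) p₀
        (hasFDerivAt_prodMk_right 0 p₀)
    have h2 : (fun p => Φ (0, p)) =
        fun p => (ContinuousLinearMap.id ℂ TorusSeq + l.smulRight (torusSingle 0)) p - p₀ := by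
      ext1 p
      simp only [Φ, riccatiRest, l, mul_zero, zero_smul, add_zero, map_smul, add_apply,
        ContinuousLinearMap.id_apply, ContinuousLinearMap.smulRight_apply, sub_apply, neg_apply,
        smul_apply, ContinuousLinearMap.comp_apply, smul_eq_mul, sub_smul, neg_smul, map_neg]
      abel
    rw [h2] at h1
    have h3 := (ContinuousLinearMap.id ℂ TorusSeq +
      l.smulRight (torusSingle 0)).hasFDerivAt.sub_const p₀ (x := p₀)
    rw [h1.unique h3]
    exact isInvertible_id_add_smulRight _ _ hl
  refine ⟨hΦ.implicitFunction (by simp) hinv,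
    (hΦ.contDiffAt_implicitFunction (by simp) hinv).analyticAt,
    hΦ.implicitFunction_apply_self (by simp) hinv, ?_⟩
  filter_upwards [hΦ.eventually_apply_implicitFunction (by simp) hinv] with ζ hζ
  rw [hΦ0] at hζ
  set p := hΦ.implicitFunction (by simp) hinv ζ
  -- The mean of `Φ = 0` isolates the solvability condition.
  have hm : torusMean (riccatiRest γ ch sh ζ p) = 0 := by
    have := congrArg torusMean hζ
    simpa [Φ, torusMean_delbarInv, torusMean_torusSingle_zero, h₀] using this
  refine ⟨hm, ?_⟩
  simp only [Φ, hm, zero_smul, add_zero] at hζ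
  rw [sub_sub, sub_sub, sub_eq_zero] at hζ
  rw [add_assoc]
  exact hζ

/-! ### A Liouville theorem for `∂̄R = aR` on the torus -/

open MeasureTheory

/-- A doubly periodic bounded solution of `∂̄R = a R` vanishes if the mean of `a` is non-zero
and small. -/
theorem eq_zero_of_delbar_eq_mul {γ : Fin 2 → ℂ} (hγ : LinearIndependent ℝ γ) (a : TorusSeq)
    {R R' : ℂ → ℂ} {C : ℝ} (hR : ∀ z, HasW R (R' z) (synth γ a z * R z) z)
    (hb : ∀ z, ‖R z‖ ≤ C) (hper : ∀ k z, R (z + γ k) = R z) (hm : torusMean a ≠ 0)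
    (hsmall : ∀ k, ‖torusMean a‖ * ‖γ k‖ < Real.pi) (z : ℂ) : R z = 0 := by
  set m := torusMean a with hmdef
  set h := synth γ (delbarInv hγ a) with hh
  -- Dividing `R` by `exp(m z̄ + h)` makes it entire; the additional holomorphic factor `exp(m̄ z)`
  -- combines with `exp(-m z̄)` to a function of modulus 1, so that `H` is also bounded, hence
  -- constant.
  set H : ℂ → ℂ := fun z => R z * Complex.exp (conj m * z - m * conj z - h z) with hH
  have hHW : ∀ z, ∃ t, HasW H t 0 z := by
    intro z
    have h1 := (((hasW_id z).const_mul (conj m)).sub ((hasW_conj z).const_mul m)).sub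
      (hasW_synth γ (delbarInv hγ a) z)
    have h2 := (hR z).mul h1.cexp
    rw [synthDelbar_delbarInv, ← hmdef] at h2
    exact ⟨_, h2.congr_deriv rfl (by ring)⟩
  choose H' hH' using hHW
  have hnorm : ∀ z, ‖Complex.exp (conj m * z - m * conj z - h z)‖ ≤
      Real.exp ‖delbarInv hγ a‖ := by
    intro z
    have e : conj m * z - m * conj z = conj m * z - conj (conj m * z) := by simp
    rw [e, sub_eq_add_neg _ (h z), Complex.exp_add, norm_mul, norm_exp_sub_conj, one_mul]
    refine (Complex.norm_exp_le_exp_norm _).trans ?_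
    rw [norm_neg]
    exact Real.exp_le_exp.2 (norm_synth_le γ _ z)
  have hHb : ∀ z, ‖H z‖ ≤ C * Real.exp ‖delbarInv hγ a‖ := by
    intro z
    rw [hH, norm_mul]
    exact mul_le_mul (hb z) (hnorm z) (norm_nonneg _) ((norm_nonneg _).trans (hb z))
  have hconst := fun w => eq_of_bounded_of_hasW hH' hHb w z
  by_contra hRz
  apply hm
  -- If the constant is not zero, the unimodular factor must be invariant under the periods. Its
  -- exponent at a period is then a multiple of `2πi`, and smallness of `m` leaves only zero,
  -- contradicting `m ≠ 0`.
  have key : ∀ k, conj m * γ k + -m * conj (γ k) = 0 := by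
    intro k
    have h1 := hconst (z + γ k)
    simp only [hH, hper k z, hh, synth_add_period hγ] at h1
    have h2 := mul_left_cancel₀ hRz h1
    rw [Complex.exp_eq_exp_iff_exists_int] at h2
    obtain ⟨n, hn⟩ := h2
    have h3 : conj m * γ k + -m * conj (γ k) = n * (2 * Real.pi * Complex.I) := by
      rw [map_add] at hn
      linear_combination hn
    have h4 : ‖conj m * γ k + -m * conj (γ k)‖ < 2 * Real.pi := by
      refine (norm_add_le _ _).trans_lt ?_
      simp only [norm_mul, norm_neg, RCLike.norm_conj]
      linarith [hsmall k]
    have h5 : ‖(n : ℂ) * (2 * Real.pi * Complex.I)‖ = |(n : ℝ)| * (2 * Real.pi) := by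
      simp [abs_of_pos Real.pi_pos]
    rw [h3, h5] at h4
    have h6 : |(n : ℝ)| < 1 := by
      have := Real.two_pi_pos
      nlinarith
    have h7 : n = 0 := by
      have : |n| < 1 := by exact_mod_cast h6
      exact Int.abs_lt_one_iff.1 this
    rw [h3, h7]; simp
  have := (eq_zero_of_forall_period hγ key).2
  simpa using this

/-! ### Fourier data of a sinh-Gordon solution -/

/-- Fourier coefficients of the functions `cosh 2u`, `sinh 2u` and `∂u`. -/
structure FourierData (u : ℂ → ℝ) (γ : Fin 2 → ℂ) where
  ch : TorusSeq
  sh : TorusSeq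
  du : TorusSeq
  synth_ch : ∀ z, synth γ ch z = (Real.cosh (2 * u z) : ℂ)
  synth_sh : ∀ z, synth γ sh z = (Real.sinh (2 * u z) : ℂ)
  synth_du : ∀ z, synth γ du z = del (cplx u) z
  mean_ch_ne_zero : torusMean ch ≠ 0
  mean_du : torusMean du = 0
  mean_ch_du : torusMean (torusMul γ ch du) = 0

section solution
variable {u : ℂ → ℝ} {γ : Fin 2 → ℂ}

theorem contDiff_cplx (hu : ContDiff ℝ ∞ u) : ContDiff ℝ ∞ (cplx u) :=
  Complex.ofRealCLM.contDiff.comp hu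

theorem hasW_cplx (hu : ContDiff ℝ ∞ u) (z : ℂ) :
    HasW (cplx u) (del (cplx u) z) (delbar (cplx u) z) z :=
  hasW_of_differentiableAt ((contDiff_cplx hu).differentiable (by simp) z)

theorem hasW_cosh (hu : ContDiff ℝ ∞ u) (z : ℂ) :
    HasW (fun z => (Real.cosh (2 * u z) : ℂ)) (2 * del (cplx u) z * Real.sinh (2 * u z))
      (2 * delbar (cplx u) z * Real.sinh (2 * u z)) z := by
  have h := ((hasW_cplx hu z).const_mul 2).comp_holomorphic (Complex.hasDerivAt_cosh _)
  have e : (fun z => (Real.cosh (2 * u z) : ℂ)) = fun w => Complex.cosh (2 * cplx u w) := by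
    ext w; simp [cplx]
  rw [e]
  exact h.congr_deriv (by simp [cplx]; ring) (by simp [cplx]; ring)

theorem hasW_sinh (hu : ContDiff ℝ ∞ u) (z : ℂ) :
    HasW (fun z => (Real.sinh (2 * u z) : ℂ)) (2 * del (cplx u) z * Real.cosh (2 * u z))
      (2 * delbar (cplx u) z * Real.cosh (2 * u z)) z := by
  have h := ((hasW_cplx hu z).const_mul 2).comp_holomorphic (Complex.hasDerivAt_sinh _)
  have e : (fun z => (Real.sinh (2 * u z) : ℂ)) = fun w => Complex.sinh (2 * cplx u w) := by
    ext w; simp [cplx]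
  rw [e]
  exact h.congr_deriv (by simp [cplx]; ring) (by simp [cplx]; ring)

/-- The `∂̄`-derivative is the sinh-Gordon equation after interchanging `∂` and `∂̄`. -/
theorem hasW_del_cplx (hu : IsSolution u) (z : ℂ) :
    HasW (del (cplx u)) (del (del (cplx u)) z) (-(1 / 2) * (Real.sinh (2 * u z) : ℂ)) z := by
  have hc := contDiff_cplx hu.1
  refine (hasW_of_differentiableAt ((contDiff_del hc).differentiable (by simp) z)).congr_deriv
    rfl ?_
  rw [← del_delbar_comm hc]
  linear_combination hu.2 z

theorem periodic_del {f : ℂ → ℂ} {c : ℂ} (hf : ∀ z, f (z + c) = f z) (z : ℂ) :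
    del f (z + c) = del f z := by
  simp only [del, periodic_fderiv hf]

theorem torusAverage_cosh_ne_zero (hu : ContDiff ℝ ∞ u) (hγ : IsDoublyPeriodic u γ) :
    torusAverage γ (fun z => (Real.cosh (2 * u z) : ℂ)) ≠ 0 := by
  rw [torusAverage_eq hγ.1, integral_complex_ofReal]
  have hcont : Continuous fun z => Real.cosh (2 * u (periodMap γ z)) :=
    Real.continuous_cosh.comp (continuous_const.mul (hu.continuous.comp (periodMap γ).continuous))
  have hb : Bornology.IsBounded unitSquare :=
    (Metric.isBounded_Ico 0 1).reProdIm (Metric.isBounded_Ico 0 1)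
  have hint : IntegrableOn (fun z => Real.cosh (2 * u (periodMap γ z))) unitSquare :=
    (hcont.continuousOn.integrableOn_compact hb.isCompact_closure).mono_set subset_closure
  have h1 : (1 : ℝ) ≤ ∫ z in unitSquare, Real.cosh (2 * u (periodMap γ z)) := by
    have h2 := setIntegral_mono_on (f := fun _ => (1 : ℝ))
      (integrableOn_const hb.measure_lt_top.ne) hint measurableSet_unitSquare
      (fun z _ => Real.one_le_cosh _)
    -- The average of the constant 1, written as a trigonometric series, yields the area of the unit
    -- square.
    have h3 := torusAverage_trigSeries hγ.1 (c := fun n => if n = 0 then (1 : ℂ) else 0)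
      (hasSum_ite_eq 0 1).summable
    rw [torusAverage_eq hγ.1] at h3
    have h4 : ∀ z, trigSeries γ (fun n => if n = 0 then (1 : ℂ) else 0) z = 1 := fun z => by
      rw [trigSeries, tsum_eq_single 0]
      · simp
      · intro n hn; simp [hn]
    simp only [h4, setIntegral_const] at h3 h2
    have h5 := congrArg Complex.re h3
    simp at h5
    simp [h5] at h2
    exact h2
  exact_mod_cast (by linarith : (∫ z in unitSquare, Real.cosh (2 * u (periodMap γ z))) ≠ 0)

theorem exists_fourierData (hu : IsSolution u) (hγ : IsDoublyPeriodic u γ) :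
    Nonempty (FourierData u γ) := by
  have hc := contDiff_cplx hu.1
  have hper : ∀ k z, cplx u (z + γ k) = cplx u z := fun k z => by simp [cplx, hγ.2 k z]
  have hchc : ContDiff ℝ ∞ fun z => (Real.cosh (2 * u z) : ℂ) :=
    Complex.ofRealCLM.contDiff.comp (Real.contDiff_cosh.comp (contDiff_const.mul hu.1))
  have hshc : ContDiff ℝ ∞ fun z => (Real.sinh (2 * u z) : ℂ) :=
    Complex.ofRealCLM.contDiff.comp (Real.contDiff_sinh.comp (contDiff_const.mul hu.1))
  obtain ⟨b, hb⟩ := exists_synth_eq hγ.1 hper hc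
  obtain ⟨ch, hch⟩ := exists_synth_eq hγ.1 (fun k z => by simp only [hγ.2 k z]) hchc
  obtain ⟨sh, hsh⟩ := exists_synth_eq hγ.1 (fun k z => by simp only [hγ.2 k z]) hshc
  obtain ⟨du, hdu⟩ := exists_synth_eq hγ.1 (fun k z => periodic_del (hper k) z) (contDiff_del hc)
  refine ⟨⟨ch, sh, du, hch, hsh, hdu, ?_, ?_, ?_⟩⟩
  · rw [← torusAverage_synth hγ.1, show synth γ ch = _ from funext hch]
    exact torusAverage_cosh_ne_zero hu.1 hγ
  · have h1 : synth γ du = synthDel γ b := by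
      ext z
      rw [hdu, ← (hasW_synth γ b z).del_eq, show synth γ b = cplx u from funext hb]
    rw [← torusAverage_synth hγ.1, h1, torusAverage_synthDel hγ.1]
  -- The product `cosh 2u ∂u` is `∂` of `(1/2) sinh 2u`, so its mean vanishes.
  · have h2 : synth γ (torusMul γ ch du) = synthDel γ ((1 / 2 : ℂ) • sh) := by
      ext z
      have h3 : synth γ ((1 / 2 : ℂ) • sh) = fun z => (1 / 2) * (Real.sinh (2 * u z) : ℂ) := by
        ext w
        rw [← synthCLM_apply, map_smul, synthCLM_apply, hsh, smul_eq_mul]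
      rw [synth_torusMul, hch, hdu, ← (hasW_synth γ _ z).del_eq, h3,
        ((hasW_sinh hu.1 z).const_mul (1 / 2)).del_eq]
      ring
    rw [← torusAverage_synth hγ.1, h2, torusAverage_synthDel hγ.1]

end solution

/-! ### The Floquet solution attached to a Riccati solution -/

theorem synth_add (γ : Fin 2 → ℂ) (a b : TorusSeq) (z : ℂ) :
    synth γ (a + b) z = synth γ a z + synth γ b z := by
  simp only [← synthCLM_apply, map_add]

theorem synth_sub (γ : Fin 2 → ℂ) (a b : TorusSeq) (z : ℂ) :
    synth γ (a - b) z = synth γ a z - synth γ b z := by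
  simp only [← synthCLM_apply, map_sub]

theorem synth_smul (γ : Fin 2 → ℂ) (c : ℂ) (a : TorusSeq) (z : ℂ) :
    synth γ (c • a) z = c * synth γ a z := by
  simp only [← synthCLM_apply, map_smul, smul_eq_mul]

section solution
variable {u : ℂ → ℝ} {γ : Fin 2 → ℂ}

/-- `p` solves the `∂̄`-equation `∂̄p = (i/2)(sinh 2u - 2ζ cosh 2u p + ζ² sinh 2u p²)`,
on the level of coefficients. -/
structure IsRiccatiSolution (hγ : LinearIndependent ℝ γ) (D : FourierData u γ) (ζ : ℂ)
    (p : TorusSeq) : Prop where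
  mean_rest : torusMean (riccatiRest γ D.ch D.sh ζ p) = 0
  eq : p = (-Complex.I) • D.du + torusMean p • torusSingle 0 +
    ζ • delbarInv hγ (riccatiRest γ D.ch D.sh ζ p)

/-- The coefficients of `(i ζ / 2) (cosh 2u - ζ sinh 2u p)`, the function `∂̄ ln f`. -/
noncomputable def logDelbar (D : FourierData u γ) (ζ : ℂ) (p : TorusSeq) : TorusSeq :=
  (Complex.I / 2 * ζ) • (D.ch - ζ • torusMul γ D.sh p)

theorem synth_logDelbar (D : FourierData u γ) (ζ : ℂ) (p : TorusSeq) (z : ℂ) :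
    synth γ (logDelbar D ζ p) z = Complex.I / 2 * ζ *
      ((Real.cosh (2 * u z) : ℂ) - ζ * (Real.sinh (2 * u z) * synth γ p z)) := by
  rw [logDelbar, synth_smul, synth_sub, synth_smul, synth_torusMul, D.synth_ch, D.synth_sh]

variable {hγ : LinearIndependent ℝ γ} {D : FourierData u γ} {ζ : ℂ} {p : TorusSeq}

/-- Apply `∂̄` to the integrated equation: `-i∂u` contributes `(i/2) sinh 2u`, the constant nothing,
and `delbarInv` is undone exactly because the rest has mean zero. -/
theorem IsRiccatiSolution.synthDelbar_eq (hu : IsSolution u) (h : IsRiccatiSolution hγ D ζ p)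
    (z : ℂ) : synthDelbar γ p z = Complex.I / 2 * ((Real.sinh (2 * u z) : ℂ)
      - 2 * ζ * ((Real.cosh (2 * u z) : ℂ) * synth γ p z)
      + ζ ^ 2 * ((Real.sinh (2 * u z) : ℂ) * (synth γ p z * synth γ p z))) := by
  have hW := (((hasW_del_cplx hu z).const_mul (-Complex.I)).add
    (hasW_const (torusMean p) z)).add
    ((hasW_synth γ (delbarInv hγ (riccatiRest γ D.ch D.sh ζ p)) z).const_mul ζ)
  have hf : (fun w => -Complex.I * del (cplx u) w + torusMean p +
      ζ * synth γ (delbarInv hγ (riccatiRest γ D.ch D.sh ζ p)) w) = synth γ p := by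
    ext w
    conv_rhs => rw [h.eq]
    rw [synth_add, synth_add, synth_smul, synth_smul, synth_smul, synth_torusSingle_zero,
      D.synth_du, mul_one]
  rw [hf] at hW
  rw [← (hasW_synth γ p z).delbar_eq, hW.delbar_eq, synthDelbar_delbarInv, h.mean_rest,
    riccatiRest, synth_add, synth_smul, synth_smul, synth_torusMul, synth_torusMul,
    synth_torusMul, D.synth_ch, D.synth_sh]
  ring

/-- This is the other Riccati equation, singular at `ζ = 0`. By compatibility of the two, its defect
solves a homogeneous linear `∂̄`-equation, whose coefficient `-2 ∂̄ ln f` has small non-zero mean;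
the Liouville theorem makes the defect vanish. -/
theorem IsRiccatiSolution.synthDel_eq (hu : IsSolution u) (h : IsRiccatiSolution hγ D ζ p)
    (hper : ∀ k z, u (z + γ k) = u z)
    (hm : torusMean (logDelbar D ζ p) ≠ 0)
    (hsmall : ∀ k, 2 * ‖torusMean (logDelbar D ζ p)‖ * ‖γ k‖ < Real.pi) (z : ℂ) :
    ζ * synthDel γ p z = -Complex.I * synth γ p z +
      del (cplx u) z * (1 - ζ ^ 2 * (synth γ p z * synth γ p z)) := by
  set R : ℂ → ℂ := fun z => ζ * synthDel γ p z + Complex.I * synth γ p z -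
    del (cplx u) z * (1 - ζ ^ 2 * (synth γ p z * synth γ p z)) with hRdef
  have hR : ∀ z, ∃ t, HasW R t (synth γ ((-2 : ℂ) • logDelbar D ζ p) z * R z) z := by
    intro z
    have hp := (hasW_synth γ p z).congr_deriv rfl (h.synthDelbar_eq hu z)
    have hG := (((hasW_sinh hu.1 z).sub (((hasW_cosh hu.1 z).mul hp).const_mul (2 * ζ))).add
      (((hasW_sinh hu.1 z).mul (hp.mul hp)).const_mul (ζ ^ 2))).const_mul (Complex.I / 2)
    obtain ⟨t, ht⟩ := exists_hasW_synthDel (h.synthDelbar_eq hu) hG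
    have hW := ((ht.const_mul ζ).add (hp.const_mul Complex.I)).sub
      ((hasW_del_cplx hu z).mul ((hasW_const 1 z).sub ((hp.mul hp).const_mul (ζ ^ 2))))
    refine ⟨_, hW.congr_deriv rfl ?_⟩
    rw [synth_smul, synth_logDelbar, hRdef]
    linear_combination (1 / 2 * Real.sinh (2 * u z) - 1 / 2 * ζ ^ 2 *
      Real.sinh (2 * u z) * synth γ p z ^ 2) * Complex.I_sq
  choose R' hR' using hR
  obtain ⟨C, hC⟩ := norm_synthDel_le γ p
  have hb : ∀ z, ‖R z‖ ≤ ‖ζ‖ * C + ‖p‖ + ‖D.du‖ * (1 + ‖ζ‖ ^ 2 * (‖p‖ * ‖p‖)) := by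
    intro z
    have h1 := norm_synth_le γ p z
    have h2 := norm_synth_le γ D.du z
    rw [D.synth_du] at h2
    refine (norm_sub_le _ _).trans (add_le_add ((norm_add_le _ _).trans (add_le_add ?_ ?_)) ?_)
    · rw [norm_mul]; exact mul_le_mul_of_nonneg_left (hC z) (norm_nonneg _)
    · rwa [norm_mul, Complex.norm_I, one_mul]
    · rw [norm_mul]
      refine mul_le_mul h2 ((norm_sub_le _ _).trans ?_) (norm_nonneg _) (norm_nonneg _)
      rw [norm_one, norm_mul, norm_mul, norm_pow]
      gcongr
  have hRper : ∀ k z, R (z + γ k) = R z := by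
    intro k z
    have h1 : ∀ w, cplx u (w + γ k) = cplx u w := fun w => by simp [cplx, hper k w]
    simp only [hRdef, synth_add_period hγ, periodic_del h1]
    rw [synthDel, trigSeries_add_period hγ]
  have hmean : torusMean ((-2 : ℂ) • logDelbar D ζ p) = -2 * torusMean (logDelbar D ζ p) := by
    rw [map_smul, smul_eq_mul]
  have h0 := eq_zero_of_delbar_eq_mul hγ _ hR' hb hRper (by rw [hmean]; simpa using hm)
    (fun k => by rw [hmean, norm_mul]; simpa using hsmall k) z
  simp only [hRdef] at h0
  linear_combination h0

/-- The coefficient `κ⁺` of `z` in the logarithm of the Floquet solution. -/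
noncomputable def kappaPlus (D : FourierData u γ) (ζ : ℂ) (p : TorusSeq) : ℂ :=
  Complex.I / (2 * ζ) + ζ * torusMean (torusMul γ D.du p)

/-- The coefficient `κ⁻` of `z̄` in the logarithm of the Floquet solution. -/
noncomputable def kappaMinus (D : FourierData u γ) (ζ : ℂ) (p : TorusSeq) : ℂ :=
  Complex.I / 2 * ζ * (torusMean D.ch - ζ * torusMean (torusMul γ D.sh p))

theorem torusMean_logDelbar (D : FourierData u γ) (ζ : ℂ) (p : TorusSeq) :
    torusMean (logDelbar D ζ p) = kappaMinus D ζ p := by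
  simp [logDelbar, kappaMinus]

/-- The common scalar factor of the Floquet solution. -/
noncomputable def floquetFactor (hγ : LinearIndependent ℝ γ) (D : FourierData u γ) (ζ : ℂ)
    (p : TorusSeq) (z : ℂ) : ℂ :=
  Complex.exp (kappaPlus D ζ p * z + kappaMinus D ζ p * conj z +
    synth γ (delbarInv hγ (logDelbar D ζ p)) z)

theorem floquetFactor_add_period (k : Fin 2) (z : ℂ) :
    floquetFactor hγ D ζ p (z + γ k) =
      Complex.exp (γ k * kappaPlus D ζ p + conj (γ k) * kappaMinus D ζ p) *
        floquetFactor hγ D ζ p z := by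
  rw [floquetFactor, floquetFactor, ← Complex.exp_add, synth_add_period hγ, map_add]
  ring_nf

/-- The prescribed `∂̄ ln f` is integrated by `delbarInv`, its mean giving the term `κ⁻ z̄`. The
`∂`-derivative comes from compatibility, up to a constant absorbed in `κ⁺`. -/
theorem IsRiccatiSolution.hasW_floquetFactor (hu : IsSolution u) (h : IsRiccatiSolution hγ D ζ p)
    (hdel : ∀ z, ζ * synthDel γ p z = -Complex.I * synth γ p z +
      del (cplx u) z * (1 - ζ ^ 2 * (synth γ p z * synth γ p z))) (z : ℂ) :
    HasW (floquetFactor hγ D ζ p)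
      ((Complex.I / (2 * ζ) + ζ * (del (cplx u) z * synth γ p z)) * floquetFactor hγ D ζ p z)
      (Complex.I / 2 * ζ * ((Real.cosh (2 * u z) : ℂ) -
        ζ * (Real.sinh (2 * u z) * synth γ p z)) * floquetFactor hγ D ζ p z) z := by
  set w := delbarInv hγ (logDelbar D ζ p) with hw
  have hwbar : ∀ z, synthDelbar γ w z = Complex.I / 2 * ζ * ((Real.cosh (2 * u z) : ℂ) -
      ζ * (Real.sinh (2 * u z) * synth γ p z)) - kappaMinus D ζ p := fun z => by
    rw [hw, synthDelbar_delbarInv, synth_logDelbar, torusMean_logDelbar]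
  -- The difference between `∂w` and its expected value is holomorphic, by the `∂`-equation for `p`,
  -- and bounded; hence it is constant.
  set V : ℂ → ℂ := fun z => synthDel γ w z - ζ * (del (cplx u) z * synth γ p z) with hVdef
  have hV : ∀ z, ∃ t, HasW V t 0 z := by
    intro z
    have hp := (hasW_synth γ p z).congr_deriv rfl (h.synthDelbar_eq hu z)
    have hG := (((hasW_cosh hu.1 z).sub (((hasW_sinh hu.1 z).mul hp).const_mul ζ)).const_mul
      (Complex.I / 2 * ζ)).sub (hasW_const (kappaMinus D ζ p) z)
    obtain ⟨t, ht⟩ := exists_hasW_synthDel hwbar hG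
    have hW := ht.sub (((hasW_del_cplx hu z).mul hp).const_mul ζ)
    refine ⟨_, hW.congr_deriv rfl ?_⟩
    linear_combination (-(Complex.I / 2) * ζ * Real.sinh (2 * u z)) * hdel z +
      (1 / 2 * ζ * Real.sinh (2 * u z) * synth γ p z) * Complex.I_sq
  choose V' hV' using hV
  obtain ⟨C, hC⟩ := norm_synthDel_le γ w
  have hVb : ∀ z, ‖V z‖ ≤ C + ‖ζ‖ * (‖D.du‖ * ‖p‖) := by
    intro z
    refine (norm_sub_le _ _).trans (add_le_add (hC z) ?_)
    have h1 := norm_synth_le γ p z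
    have h2 := norm_synth_le γ D.du z
    rw [D.synth_du] at h2
    rw [norm_mul, norm_mul]
    gcongr
  have hVconst := fun z => eq_of_bounded_of_hasW hV' hVb z 0
  -- Since `∂w` has mean zero, averaging determines the constant.
  have hV0 : V 0 = -(ζ * torusMean (torusMul γ D.du p)) := by
    have h1 : ∀ z, synthDel γ w z = synth γ (V 0 • torusSingle 0 + ζ • torusMul γ D.du p) z := by
      intro z
      rw [synth_add, synth_smul, synth_smul, synth_torusSingle_zero, synth_torusMul, D.synth_du,
        ← hVconst z, hVdef]
      ring
    have h2 := torusAverage_synthDel hγ w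
    rw [show synthDel γ w = _ from funext h1, torusAverage_synth hγ] at h2
    simp only [map_add, map_smul, torusMean_torusSingle_zero, smul_eq_mul, mul_one] at h2
    linear_combination h2
  have hwdel : synthDel γ w z = ζ * (del (cplx u) z * synth γ p z) -
      ζ * torusMean (torusMul γ D.du p) := by
    have := hVconst z
    rw [hV0] at this
    simp only [hVdef] at this
    linear_combination this
  have hW := ((((hasW_id z).const_mul (kappaPlus D ζ p)).add
    ((hasW_conj z).const_mul (kappaMinus D ζ p))).add (hasW_synth γ w z)).cexp
  refine hW.congr_deriv ?_ ?_
  · rw [hwdel, floquetFactor, ← hw]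
    generalize Complex.exp _ = E
    rw [kappaPlus]
    ring
  · rw [hwbar, floquetFactor]
    ring

/-- The first component of the Floquet solution. -/
noncomputable def floquetFst (hγ : LinearIndependent ℝ γ) (D : FourierData u γ) (ζ : ℂ)
    (p : TorusSeq) (z : ℂ) : ℂ :=
  ζ * (Complex.exp (-1 / 2 * cplx u z) * ((1 + ζ * synth γ p z) * floquetFactor hγ D ζ p z))

/-- The second component of the Floquet solution. -/
noncomputable def floquetSnd (hγ : LinearIndependent ℝ γ) (D : FourierData u γ) (ζ : ℂ)
    (p : TorusSeq) (z : ℂ) : ℂ :=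
  Complex.exp (1 / 2 * cplx u z) * ((1 - ζ * synth γ p z) * floquetFactor hγ D ζ p z)

/-- After substitution of the derivatives of `p` and `f`, each component is an algebraic identity
modulo `ζζ⁻¹ = 1`, `e^{u/2} e^{-u/2} = 1` and the `∂`-equation `hdel`. -/
theorem IsRiccatiSolution.isEigenfunction (hu : IsSolution u) (h : IsRiccatiSolution hγ D ζ p)
    (hζ : ζ ≠ 0)
    (hdel : ∀ z, ζ * synthDel γ p z = -Complex.I * synth γ p z +
      del (cplx u) z * (1 - ζ ^ 2 * (synth γ p z * synth γ p z))) :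
    IsEigenfunction u (ζ ^ 2) (floquetFst hγ D ζ p) (floquetSnd hγ D ζ p) := by
  have hp := fun z => (hasW_synth γ p z).congr_deriv rfl (h.synthDelbar_eq hu z)
  have hf := h.hasW_floquetFactor hu hdel
  have h1 := fun z => ((((hasW_cplx hu.1 z).const_mul (-1 / 2)).cexp).mul
    (((hasW_const 1 z).add ((hp z).const_mul ζ)).mul (hf z))).const_mul ζ
  have h2 := fun z => (((hasW_cplx hu.1 z).const_mul (1 / 2)).cexp).mul
    (((hasW_const 1 z).sub ((hp z).const_mul ζ)).mul (hf z))
  have e1 : ∀ z, (Real.exp (u z) : ℂ) =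
      Complex.exp (1 / 2 * cplx u z) * Complex.exp (1 / 2 * cplx u z) := fun z => by
    rw [← Complex.exp_add, Complex.ofReal_exp]; congr 1; simp [cplx]; ring
  have e2 : ∀ z, (Real.exp (-u z) : ℂ) =
      Complex.exp (-1 / 2 * cplx u z) * Complex.exp (-1 / 2 * cplx u z) := fun z => by
    rw [← Complex.exp_add, Complex.ofReal_exp]; congr 1; simp [cplx]; ring
  have e3 : ∀ z, Complex.exp (1 / 2 * cplx u z) * Complex.exp (-1 / 2 * cplx u z) = 1 :=
    fun z => by
      rw [← Complex.exp_add, ← Complex.exp_zero]; congr 1; ring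
  have e4 : ∀ z, (Real.cosh (2 * u z) : ℂ) =
      (Real.exp (u z) ^ 2 + Real.exp (-u z) ^ 2 : ℂ) / 2 := fun z => by
    rw [Real.cosh_eq, ← Complex.ofReal_pow, ← Complex.ofReal_pow, ← Real.exp_nat_mul,
      ← Real.exp_nat_mul]
    push_cast; ring_nf
  have e5 : ∀ z, (Real.sinh (2 * u z) : ℂ) =
      (Real.exp (u z) ^ 2 - Real.exp (-u z) ^ 2 : ℂ) / 2 := fun z => by
    rw [Real.sinh_eq, ← Complex.ofReal_pow, ← Complex.ofReal_pow, ← Real.exp_nat_mul,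
      ← Real.exp_nat_mul]
    push_cast; ring_nf
  have hJ : ζ * ζ⁻¹ = 1 := mul_inv_cancel₀ hζ
  let X : ℂ → ℂ := fun z => Complex.exp (1 / 2 * cplx u z)
  let Y : ℂ → ℂ := fun z => Complex.exp (-1 / 2 * cplx u z)
  let F : ℂ → ℂ := floquetFactor hγ D ζ p
  refine ⟨fun z => (h1 z).differentiableAt, fun z => (h2 z).differentiableAt, fun z => ?_,
    fun z => ?_, fun z => ?_, fun z => ?_⟩
  · refine (h1 z).del_eq.trans ?_
    rw [e2, floquetFst, floquetSnd]
    linear_combination (ζ * Y z * F z) * hdel z +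
      (-(1 / 2) * Complex.I * Y z * (1 - ζ * synth γ p z) * F z) * e3 z +
      (1 / 2 * Complex.I * Y z * (1 + ζ * synth γ p z) * F z) * hJ
  · refine (h2 z).del_eq.trans ?_
    rw [e1, floquetFst, floquetSnd]
    linear_combination (-X z * F z) * hdel z +
      (-(1 / 2) * Complex.I * ζ⁻¹ ^ 2 * ζ * X z * (1 + ζ * synth γ p z) * F z) * e3 z +
      (-(1 / 2) * Complex.I * X z * (1 + ζ * synth γ p z) * F z * ζ⁻¹ -
        Complex.I * synth γ p z * X z * F z) * hJ
  · refine (h1 z).delbar_eq.trans ?_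
    rw [e4, e5, e1, e2, floquetFst, floquetSnd]
    linear_combination (1 / 2 * Complex.I * ζ ^ 2 * F z * (1 - ζ * synth γ p z) * X z ^ 3) * e3 z
  · refine (h2 z).delbar_eq.trans ?_
    rw [e4, e5, e1, e2, floquetFst, floquetSnd]
    linear_combination (1 / 2 * Complex.I * ζ * F z * (1 + ζ * synth γ p z) * Y z ^ 3) * e3 z

end solution

/-! ### Wronskians and multipliers -/

section wronskian
variable {u : ℂ → ℝ} {lam : ℂ} {ψ₁ ψ₂ φ₁ φ₂ χ₁ χ₂ : ℂ → ℂ}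

/-- The Wronskian of two solutions of the linear system is constant. -/
theorem wronskian_const (hψ : IsEigenfunction u lam ψ₁ ψ₂) (hφ : IsEigenfunction u lam φ₁ φ₂)
    (z w : ℂ) : ψ₁ z * φ₂ z - ψ₂ z * φ₁ z = ψ₁ w * φ₂ w - ψ₂ w * φ₁ w := by
  refine eq_of_hasW_zero (f := fun z => ψ₁ z * φ₂ z - ψ₂ z * φ₁ z) (fun z => ?_) z w
  have a1 := (hasW_of_differentiableAt (hψ.differentiable_fst z)).congr_deriv
    (hψ.del_fst z) (hψ.delbar_fst z)
  have a2 := (hasW_of_differentiableAt (hψ.differentiable_snd z)).congr_deriv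
    (hψ.del_snd z) (hψ.delbar_snd z)
  have b1 := (hasW_of_differentiableAt (hφ.differentiable_fst z)).congr_deriv
    (hφ.del_fst z) (hφ.delbar_fst z)
  have b2 := (hasW_of_differentiableAt (hφ.differentiable_snd z)).congr_deriv
    (hφ.del_snd z) (hφ.delbar_snd z)
  -- Both coefficient matrices are trace-free, so both Wirtinger derivatives of the determinant
  -- cancel.
  exact ((a1.mul b2).sub (a2.mul b1)).congr_deriv (by ring) (by ring)

/-- The multipliers of two independent Floquet solutions are inverse to each other. -/
theorem multiplier_mul_eq_one {c : Fin 2 → ℂ} {μ τ : Fin 2 → ℂ}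
    (hψ : IsEigenfunction u lam ψ₁ ψ₂) (hφ : IsEigenfunction u lam φ₁ φ₂)
    (hψμ : ∀ k z, ψ₁ (z + c k) = μ k * ψ₁ z ∧ ψ₂ (z + c k) = μ k * ψ₂ z)
    (hφτ : ∀ k z, φ₁ (z + c k) = τ k * φ₁ z ∧ φ₂ (z + c k) = τ k * φ₂ z)
    (h0 : ψ₁ 0 * φ₂ 0 - ψ₂ 0 * φ₁ 0 ≠ 0) (k : Fin 2) : μ k * τ k = 1 := by
  have h1 := wronskian_const hψ hφ (0 + c k) 0
  rw [(hψμ k 0).1, (hψμ k 0).2, (hφτ k 0).1, (hφτ k 0).2] at h1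
  have h2 : (μ k * τ k) * (ψ₁ 0 * φ₂ 0 - ψ₂ 0 * φ₁ 0) =
      1 * (ψ₁ 0 * φ₂ 0 - ψ₂ 0 * φ₁ 0) := by linear_combination h1
  exact mul_right_cancel₀ h0 h2

/-- A non-zero Floquet solution has the multipliers of one of two given independent ones. -/
theorem multiplier_eq_or_eq {c : Fin 2 → ℂ} {μ ν ρ : Fin 2 → ℂ}
    (hψ : IsEigenfunction u lam ψ₁ ψ₂) (hφ : IsEigenfunction u lam φ₁ φ₂)
    (hχ : IsEigenfunction u lam χ₁ χ₂)
    (hψμ : ∀ k z, ψ₁ (z + c k) = μ k * ψ₁ z ∧ ψ₂ (z + c k) = μ k * ψ₂ z)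
    (hφν : ∀ k z, φ₁ (z + c k) = ν k * φ₁ z ∧ φ₂ (z + c k) = ν k * φ₂ z)
    (hχρ : ∀ k z, χ₁ (z + c k) = ρ k * χ₁ z ∧ χ₂ (z + c k) = ρ k * χ₂ z)
    (hW : φ₁ 0 * χ₂ 0 - φ₂ 0 * χ₁ 0 ≠ 0)
    (hne : ∃ z, ψ₁ z ≠ 0 ∨ ψ₂ z ≠ 0) : μ = ν ∨ μ = ρ := by
  have hνρ := multiplier_mul_eq_one hφ hχ hφν hχρ hW
  have hinv : ∀ {a b c : ℂ}, a * b = 1 → c * b = 1 → a = c := fun {a b c} h1 h2 => by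
    linear_combination c * h1 - a * h2
  by_cases h1 : ψ₁ 0 * χ₂ 0 - ψ₂ 0 * χ₁ 0 = 0
  · by_cases h2 : ψ₁ 0 * φ₂ 0 - ψ₂ 0 * φ₁ 0 = 0
    -- If both Wronskians vanish at `0`, they vanish everywhere; then `ψ` is everywhere proportional
    -- to two independent vectors, hence zero.
    · exfalso
      obtain ⟨z, hz⟩ := hne
      have e1 := wronskian_const hψ hχ z 0
      have e2 := wronskian_const hψ hφ z 0
      have e3 := wronskian_const hφ hχ z 0
      rw [h1] at e1
      rw [h2] at e2
      rw [← e3] at hW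
      have f1 : ψ₁ z * (φ₁ z * χ₂ z - φ₂ z * χ₁ z) = 0 := by
        linear_combination φ₁ z * e1 - χ₁ z * e2
      have f2 : ψ₂ z * (φ₁ z * χ₂ z - φ₂ z * χ₁ z) = 0 := by
        linear_combination φ₂ z * e1 - χ₂ z * e2
      rcases hz with hz | hz
      · exact (mul_ne_zero hz hW) f1
      · exact (mul_ne_zero hz hW) f2
    · right
      ext k
      have h3 := multiplier_mul_eq_one hψ hφ hψμ hφν h2 k
      exact hinv h3 (by rw [mul_comm]; exact hνρ k)
  · left
    ext k
    exact hinv (multiplier_mul_eq_one hψ hχ hψμ hχρ h1 k) (hνρ k)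

end wronskian

/-! ### Parameters for which the construction works -/

section solution
variable {u : ℂ → ℝ} {γ : Fin 2 → ℂ} {hγ : LinearIndependent ℝ γ} {D : FourierData u γ}

/-- The conditions on a parameter `ζ` under which the Floquet solutions with parameters `±ζ` are
independent and have different multipliers. -/
structure IsGoodParam (hγ : LinearIndependent ℝ γ) (D : FourierData u γ) (P : ℂ → TorusSeq)
    (ζ : ℂ) : Prop where
  analyticAt : AnalyticAt ℂ P ζ
  riccati : IsRiccatiSolution hγ D ζ (P ζ)
  norm_lt : ‖ζ‖ * ‖P ζ‖ < 1
  exponent_lt : ∀ k, ‖γ k * (ζ * torusMean (torusMul γ D.du (P ζ))) +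
    conj (γ k) * kappaMinus D ζ (P ζ)‖ < Real.pi
  kappaMinus_lt : ∀ k, 2 * ‖kappaMinus D ζ (P ζ)‖ * ‖γ k‖ < Real.pi
  kappaMinus_ne : ζ ≠ 0 → kappaMinus D ζ (P ζ) ≠ 0
  kappa_ne : ζ ≠ 0 → kappaPlus D ζ (P ζ) + conj (kappaMinus D ζ (P ζ)) ≠ 0

theorem analyticAt_mean_torusMul (γ : Fin 2 → ℂ) (a : TorusSeq) {P : ℂ → TorusSeq} {ζ : ℂ}
    (hP : AnalyticAt ℂ P ζ) : AnalyticAt ℂ (fun ζ => torusMean (torusMul γ a (P ζ))) ζ :=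
  ((torusMean.comp (torusMul γ a)).analyticAt (P ζ)).comp hP

theorem analyticAt_kappaMinus (D : FourierData u γ) {P : ℂ → TorusSeq} {ζ : ℂ}
    (hP : AnalyticAt ℂ P ζ) : AnalyticAt ℂ (fun ζ => kappaMinus D ζ (P ζ)) ζ := by
  unfold kappaMinus
  have := analyticAt_mean_torusMul γ D.sh hP
  fun_prop

/-- The mean-zero hypotheses of the implicit function argument hold for `p₀ = -i∂u`; all remaining
conditions are open and hold near `ζ = 0` by continuity. -/
theorem exists_goodParam_family (hγ : LinearIndependent ℝ γ) (D : FourierData u γ) :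
    ∃ P : ℂ → TorusSeq, P 0 = (-Complex.I) • D.du ∧ ∃ r > 0, ∀ ζ ∈ Metric.ball (0 : ℂ) r,
      IsGoodParam hγ D P ζ := by
  obtain ⟨P, hP, hP0, hR⟩ := exists_riccati_family hγ D.ch D.sh ((-Complex.I) • D.du)
    D.mean_ch_ne_zero (by rw [map_smul, D.mean_du, smul_zero])
    (by rw [map_smul, map_smul, D.mean_ch_du, smul_zero])
  refine ⟨P, hP0, ?_⟩
  have hα := analyticAt_mean_torusMul γ D.du hP
  have hσ := analyticAt_mean_torusMul γ D.sh hP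
  have hκ := analyticAt_kappaMinus D hP
  have hPc := hP.continuousAt
  have hαc := hα.continuousAt
  have hσc := hσ.continuousAt
  have hκc := hκ.continuousAt
  have hκ0 : kappaMinus D 0 (P 0) = 0 := by simp [kappaMinus]
  have e1 : ∀ᶠ ζ in 𝓝 (0 : ℂ), ‖ζ‖ * ‖P ζ‖ < 1 := by
    have : ContinuousAt (fun ζ : ℂ => ‖ζ‖ * ‖P ζ‖) 0 := by fun_prop
    exact this.eventually_lt continuousAt_const (by simp)
  have e2 : ∀ᶠ ζ in 𝓝 (0 : ℂ), ∀ k, ‖γ k * (ζ * torusMean (torusMul γ D.du (P ζ))) +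
      conj (γ k) * kappaMinus D ζ (P ζ)‖ < Real.pi := by
    refine Filter.eventually_all.2 fun k => ?_
    have : ContinuousAt (fun ζ : ℂ => ‖γ k * (ζ * torusMean (torusMul γ D.du (P ζ))) +
      conj (γ k) * kappaMinus D ζ (P ζ)‖) 0 := by fun_prop
    exact this.eventually_lt continuousAt_const (by simp [hκ0, Real.pi_pos])
  have e3 : ∀ᶠ ζ in 𝓝 (0 : ℂ), ∀ k, 2 * ‖kappaMinus D ζ (P ζ)‖ * ‖γ k‖ < Real.pi := by
    refine Filter.eventually_all.2 fun k => ?_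
    have : ContinuousAt (fun ζ : ℂ => 2 * ‖kappaMinus D ζ (P ζ)‖ * ‖γ k‖) 0 := by fun_prop
    exact this.eventually_lt continuousAt_const (by simp [hκ0, Real.pi_pos])
  have e4 : ∀ᶠ ζ in 𝓝 (0 : ℂ), torusMean D.ch - ζ * torusMean (torusMul γ D.sh (P ζ)) ≠ 0 := by
    have : ContinuousAt (fun ζ : ℂ => torusMean D.ch - ζ * torusMean (torusMul γ D.sh (P ζ))) 0 := by
      fun_prop
    exact this.eventually_ne (by simpa using D.mean_ch_ne_zero)
  have e5 : ∀ᶠ ζ in 𝓝 (0 : ℂ), ‖ζ ^ 2 * torusMean (torusMul γ D.du (P ζ))‖ < 1 / 4 := by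
    have : ContinuousAt (fun ζ : ℂ => ‖ζ ^ 2 * torusMean (torusMul γ D.du (P ζ))‖) 0 := by
      fun_prop
    exact this.eventually_lt continuousAt_const (by simp)
  have e6 : ∀ᶠ ζ in 𝓝 (0 : ℂ), ‖ζ * kappaMinus D ζ (P ζ)‖ < 1 / 4 := by
    have : ContinuousAt (fun ζ : ℂ => ‖ζ * kappaMinus D ζ (P ζ)‖) 0 := by fun_prop
    exact this.eventually_lt continuousAt_const (by simp)
  have key : ∀ᶠ ζ in 𝓝 (0 : ℂ), IsGoodParam hγ D P ζ := by
    filter_upwards [hP.eventually_analyticAt, hR, e1, e2, e3, e4, e5, e6] with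
      ζ h0 h1 h2 h3 h4 h5 h6 h7
    refine ⟨h0, ⟨h1.1, h1.2⟩, h2, h3, h4, fun hζ => ?_, fun hζ hk => ?_⟩
    · rw [kappaMinus]
      exact mul_ne_zero (mul_ne_zero (by simp) hζ) h5
    -- After multiplication by `ζ` the pole of `κ⁺` becomes `i/2`, of modulus `1/2`, while both
    -- corrections are below `1/4`; so `κ⁺` cannot be cancelled by the conjugate of `κ⁻`.
    · have k1 : ζ * kappaPlus D ζ (P ζ) =
          Complex.I / 2 + ζ ^ 2 * torusMean (torusMul γ D.du (P ζ)) := by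
        rw [kappaPlus]; field_simp
      have k2 : ‖ζ * kappaPlus D ζ (P ζ)‖ = ‖ζ * kappaMinus D ζ (P ζ)‖ := by
        rw [norm_mul, norm_mul, eq_neg_of_add_eq_zero_left hk, norm_neg, RCLike.norm_conj]
      have k3 : ‖(Complex.I / 2 : ℂ)‖ ≤ ‖ζ * kappaPlus D ζ (P ζ)‖ +
          ‖ζ ^ 2 * torusMean (torusMul γ D.du (P ζ))‖ := by
        rw [k1]
        refine le_trans (le_of_eq ?_) (norm_sub_le _ _)
        congr 1; ring
      have k4 : ‖(Complex.I / 2 : ℂ)‖ = 1 / 2 := by simp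
      rw [k4, k2] at k3
      linarith
  exact Metric.eventually_nhds_iff_ball.1 key

end solution

/-! ### The end of the spectral curve over `λ = 0` -/

section solution
variable {u : ℂ → ℝ} {γ : Fin 2 → ℂ} {D : FourierData u γ} {P : ℂ → TorusSeq} {ζ : ℂ}

/-- The exponent `γ_k κ⁺ + γ̄_k κ⁻` of the `k`-th multiplier. -/
noncomputable def exponent (D : FourierData u γ) (P : ℂ → TorusSeq) (ζ : ℂ) (k : Fin 2) : ℂ :=
  γ k * kappaPlus D ζ (P ζ) + conj (γ k) * kappaMinus D ζ (P ζ)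

theorem floquet_multiplier {hγ : LinearIndependent ℝ γ} (hper : ∀ k z, u (z + γ k) = u z)
    (k : Fin 2) (z : ℂ) :
    floquetFst hγ D ζ (P ζ) (z + γ k) =
      Complex.exp (exponent D P ζ k) * floquetFst hγ D ζ (P ζ) z ∧
    floquetSnd hγ D ζ (P ζ) (z + γ k) =
      Complex.exp (exponent D P ζ k) * floquetSnd hγ D ζ (P ζ) z := by
  have h1 : cplx u (z + γ k) = cplx u z := by simp [cplx, hper k z]
  constructor
  · rw [floquetFst, floquetFst, h1, synth_add_period hγ, floquetFactor_add_period, exponent]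
    ring
  · rw [floquetSnd, floquetSnd, h1, synth_add_period hγ, floquetFactor_add_period, exponent]
    ring

theorem IsGoodParam.isEigenfunction (hu : IsSolution u) (hγ : IsDoublyPeriodic u γ)
    (h : IsGoodParam hγ.1 D P ζ) (hζ : ζ ≠ 0) :
    IsEigenfunction u (ζ ^ 2) (floquetFst hγ.1 D ζ (P ζ)) (floquetSnd hγ.1 D ζ (P ζ)) := by
  refine h.riccati.isEigenfunction hu hζ (h.riccati.synthDel_eq hu hγ.2 ?_ ?_)
  · rw [torusMean_logDelbar]; exact h.kappaMinus_ne hζ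
  · rw [torusMean_logDelbar]; exact h.kappaMinus_lt

/-- The exponentials of `±u/2` cancel, leaving `2ζ f(ζ) f(-ζ) (1 + ζ² p(ζ) p(-ζ))`, and `|ζp| < 1`
at both parameters keeps the last factor away from zero. -/
theorem IsGoodParam.wronskian_ne_zero {hγ : LinearIndependent ℝ γ} (h : IsGoodParam hγ D P ζ)
    (h' : IsGoodParam hγ D P (-ζ)) (hζ : ζ ≠ 0) (z : ℂ) :
    floquetFst hγ D ζ (P ζ) z * floquetSnd hγ D (-ζ) (P (-ζ)) z -
      floquetSnd hγ D ζ (P ζ) z * floquetFst hγ D (-ζ) (P (-ζ)) z ≠ 0 := by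
  have e : Complex.exp (-1 / 2 * cplx u z) * Complex.exp (1 / 2 * cplx u z) = 1 := by
    rw [← Complex.exp_add, ← Complex.exp_zero]; congr 1; ring
  have h1 : floquetFst hγ D ζ (P ζ) z * floquetSnd hγ D (-ζ) (P (-ζ)) z -
      floquetSnd hγ D ζ (P ζ) z * floquetFst hγ D (-ζ) (P (-ζ)) z =
      2 * ζ * (floquetFactor hγ D ζ (P ζ) z * floquetFactor hγ D (-ζ) (P (-ζ)) z) *
        (1 + (ζ * synth γ (P ζ) z) * (ζ * synth γ (P (-ζ)) z)) := by
    simp only [floquetFst, floquetSnd]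
    linear_combination (2 * ζ * (floquetFactor hγ D ζ (P ζ) z *
      floquetFactor hγ D (-ζ) (P (-ζ)) z) *
        (1 + (ζ * synth γ (P ζ) z) * (ζ * synth γ (P (-ζ)) z))) * e
  rw [h1]
  refine mul_ne_zero (mul_ne_zero (mul_ne_zero two_ne_zero hζ) (mul_ne_zero
    (Complex.exp_ne_zero _) (Complex.exp_ne_zero _))) fun h0 => ?_
  have n1 : ‖ζ * synth γ (P ζ) z‖ < 1 := by
    rw [norm_mul]
    exact (mul_le_mul_of_nonneg_left (norm_synth_le γ _ z) (norm_nonneg _)).trans_lt h.norm_lt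
  have n2 : ‖ζ * synth γ (P (-ζ)) z‖ < 1 := by
    rw [norm_mul, ← norm_neg ζ]
    exact (mul_le_mul_of_nonneg_left (norm_synth_le γ _ z) (norm_nonneg _)).trans_lt h'.norm_lt
  have n3 : ‖(ζ * synth γ (P ζ) z) * (ζ * synth γ (P (-ζ)) z)‖ = 1 := by
    rw [eq_neg_of_add_eq_zero_right h0]; simp
  rw [norm_mul] at n3
  nlinarith [norm_nonneg (ζ * synth γ (P ζ) z), norm_nonneg (ζ * synth γ (P (-ζ)) z)]

theorem IsGoodParam.exp_mul_exp (hu : IsSolution u) (hγ : IsDoublyPeriodic u γ)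
    (h : IsGoodParam hγ.1 D P ζ) (h' : IsGoodParam hγ.1 D P (-ζ)) (hζ : ζ ≠ 0) (k : Fin 2) :
    Complex.exp (exponent D P ζ k) * Complex.exp (exponent D P (-ζ) k) = 1 := by
  have e' := h'.isEigenfunction hu hγ (neg_ne_zero.2 hζ)
  rw [neg_sq] at e'
  exact multiplier_mul_eq_one (c := γ) (μ := fun k => Complex.exp (exponent D P ζ k))
    (τ := fun k => Complex.exp (exponent D P (-ζ) k)) (h.isEigenfunction hu hγ hζ) e'
    (floquet_multiplier hγ.2) (floquet_multiplier hγ.2) (h.wronskian_ne_zero h' hζ 0) k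

/-- The coefficient of `ζ` in `κ⁺`. -/
noncomputable def alphaCoeff (D : FourierData u γ) (P : ℂ → TorusSeq) (ζ : ℂ) : ℂ :=
  torusMean (torusMul γ D.du (P ζ))

/-- The coefficient of `(i/2) ζ` in `κ⁻`. -/
noncomputable def betaCoeff (D : FourierData u γ) (P : ℂ → TorusSeq) (ζ : ℂ) : ℂ :=
  torusMean D.ch - ζ * torusMean (torusMul γ D.sh (P ζ))

theorem exponent_eq (k : Fin 2) : exponent D P ζ k =
    γ k * (Complex.I / (2 * ζ) + ζ * alphaCoeff D P ζ) +
      conj (γ k) * (Complex.I / 2 * ζ * betaCoeff D P ζ) := rfl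

/-- The multipliers at `±ζ` are inverse, so their exponents add up to a multiple of `2πi`. The odd
poles `±i/(2ζ)` cancel and the remaining sum is smaller than `2π`, hence zero; independence of the
periods separates `α` from `β`. -/
theorem IsGoodParam.even (hu : IsSolution u) (hγ : IsDoublyPeriodic u γ)
    (h : IsGoodParam hγ.1 D P ζ) (h' : IsGoodParam hγ.1 D P (-ζ)) (hζ : ζ ≠ 0) :
    alphaCoeff D P (-ζ) = alphaCoeff D P ζ ∧ betaCoeff D P (-ζ) = betaCoeff D P ζ := by
  have key : ∀ k, (ζ * (alphaCoeff D P ζ - alphaCoeff D P (-ζ))) * γ k +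
      (Complex.I / 2 * ζ * (betaCoeff D P ζ - betaCoeff D P (-ζ))) * conj (γ k) = 0 := by
    intro k
    have h1 := h.exp_mul_exp hu hγ h' hζ k
    rw [← Complex.exp_add, Complex.exp_eq_one_iff] at h1
    obtain ⟨n, hn⟩ := h1
    set a := γ k * (ζ * torusMean (torusMul γ D.du (P ζ))) +
      conj (γ k) * kappaMinus D ζ (P ζ) with ha
    set b := γ k * (-ζ * torusMean (torusMul γ D.du (P (-ζ)))) +
      conj (γ k) * kappaMinus D (-ζ) (P (-ζ)) with hb
    have h2 : exponent D P ζ k + exponent D P (-ζ) k = a + b := by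
      have : Complex.I / (2 * -ζ) = -(Complex.I / (2 * ζ)) := by rw [mul_neg, div_neg]
      rw [exponent, exponent, kappaPlus, kappaPlus, ha, hb, this]
      ring
    have h3 : ‖a + b‖ < 2 * Real.pi :=
      (norm_add_le _ _).trans_lt (by linarith [h.exponent_lt k, h'.exponent_lt k])
    have h5 : ‖(n : ℂ) * (2 * Real.pi * Complex.I)‖ = |(n : ℝ)| * (2 * Real.pi) := by
      simp [abs_of_pos Real.pi_pos]
    rw [← h2, hn, h5] at h3
    have h6 : |(n : ℝ)| < 1 := by
      have := Real.two_pi_pos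
      nlinarith
    have h7 : n = 0 := by
      have : |n| < 1 := by exact_mod_cast h6
      exact Int.abs_lt_one_iff.1 this
    rw [h2, h7, Int.cast_zero, zero_mul, ha, hb, kappaMinus, kappaMinus] at hn
    rw [alphaCoeff, alphaCoeff, betaCoeff, betaCoeff]
    linear_combination hn
  obtain ⟨h1, h2⟩ := eq_zero_of_forall_period hγ.1 key
  have h3 := (mul_eq_zero.1 h1).resolve_left hζ
  have h4 := (mul_eq_zero.1 h2).resolve_left (mul_ne_zero (by simp) hζ)
  exact ⟨(sub_eq_zero.1 h3).symm, (sub_eq_zero.1 h4).symm⟩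

/-- Equal and mutually inverse multipliers have square 1, so the exponents are purely imaginary. As
this holds for both periods, `κ⁺ + conj κ⁻ = 0`, against `kappa_ne`. -/
theorem IsGoodParam.exists_multiplier_ne (hu : IsSolution u) (hγ : IsDoublyPeriodic u γ)
    (h : IsGoodParam hγ.1 D P ζ) (h' : IsGoodParam hγ.1 D P (-ζ)) (hζ : ζ ≠ 0) :
    ∃ k, Complex.exp (exponent D P ζ k) ≠ Complex.exp (exponent D P (-ζ) k) := by
  by_contra! hk
  apply h.kappa_ne hζ
  have key : ∀ k, (kappaPlus D ζ (P ζ) + conj (kappaMinus D ζ (P ζ))) * γ k +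
      conj (kappaPlus D ζ (P ζ) + conj (kappaMinus D ζ (P ζ))) * conj (γ k) = 0 := by
    intro k
    have h1 := h.exp_mul_exp hu hγ h' hζ k
    rw [← hk k] at h1
    have h2 := congrArg norm h1
    rw [norm_mul, norm_one, Complex.norm_exp, ← Real.exp_add, Real.exp_eq_one_iff] at h2
    have h3 : exponent D P ζ k + conj (exponent D P ζ k) = 0 := by
      rw [Complex.add_conj]
      have : (exponent D P ζ k).re = 0 := by linarith
      simp [this]
    rw [exponent] at h3
    simp only [map_add, map_mul, Complex.conj_conj] at h3 ⊢
    linear_combination h3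
  exact (eq_zero_of_forall_period hγ.1 key).1

theorem analyticAt_alphaCoeff (hP : AnalyticAt ℂ P ζ) : AnalyticAt ℂ (alphaCoeff D P) ζ :=
  analyticAt_mean_torusMul γ D.du hP

theorem analyticAt_betaCoeff (hP : AnalyticAt ℂ P ζ) : AnalyticAt ℂ (betaCoeff D P) ζ := by
  have := analyticAt_mean_torusMul γ D.sh hP
  unfold betaCoeff
  fun_prop

/-- The part of the spectral curve over a punctured disc around `lam = 0`. -/
theorem exists_arc_at_zero (hu : IsSolution u) (hγ : IsDoublyPeriodic u γ) :
    ∃ (α β : ℂ → ℂ) (c : Arc (spectralCurve u γ)), AnalyticAt ℂ α 0 ∧ AnalyticAt ℂ β 0 ∧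
      (∀ᶠ ζ in 𝓝 0, α (-ζ) = α ζ) ∧ (∀ᶠ ζ in 𝓝 0, β (-ζ) = β ζ) ∧
      α 0 = -Complex.I * torusAverage γ (fun z => del (cplx u) z ^ 2) ∧
      β 0 = torusAverage γ (fun z => (Real.cosh (2 * u z) : ℂ)) ∧
      IsRootParamAtZero c ∧
      ∀ ζ ∈ c.domain, ∀ k, (c.toFun ζ).2 k = Complex.exp
        (γ k * (Complex.I / (2 * ζ) + ζ * α ζ) + conj (γ k) * (Complex.I / 2 * ζ * β ζ)) := by
  obtain ⟨D⟩ := exists_fourierData hu hγ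
  obtain ⟨P, hP0, r, hr, hP⟩ := exists_goodParam_family hγ.1 D
  have hneg : ∀ {ζ}, ζ ∈ Metric.ball (0 : ℂ) r → -ζ ∈ Metric.ball (0 : ℂ) r := fun {ζ} hζ => by
    simpa using hζ
  have hev : ∀ ζ ∈ Metric.ball (0 : ℂ) r, alphaCoeff D P (-ζ) = alphaCoeff D P ζ ∧
      betaCoeff D P (-ζ) = betaCoeff D P ζ := by
    intro ζ hζ
    by_cases h0 : ζ = 0
    · simp [h0]
    · exact (hP ζ hζ).even hu hγ (hP _ (hneg hζ)) h0
  have hball : Metric.ball (0 : ℂ) r ∈ 𝓝 (0 : ℂ) := Metric.ball_mem_nhds 0 hr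
  let S := Metric.ball (0 : ℂ) r \ {0}
  let F : ℂ → ℂ × (Fin 2 → ℂ) := fun ζ => (ζ ^ 2, fun k => Complex.exp (exponent D P ζ k))
  have hmaps : Set.MapsTo F S (spectralCurve u γ) := by
    intro ζ hζ
    have hg := hP ζ hζ.1
    have hg' := hP (-ζ) (hneg hζ.1)
    have h0 : ζ ≠ 0 := hζ.2
    refine ⟨pow_ne_zero 2 h0, _, _, hg.isEigenfunction hu hγ h0, ⟨0, ?_⟩,
      floquet_multiplier hγ.2⟩
    by_contra! h
    apply hg.wronskian_ne_zero hg' h0 0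
    rw [h.1, h.2]; ring
  have hdiff : DifferentiableOn ℂ F S := by
    intro ζ hζ
    have h0 : ζ ≠ 0 := hζ.2
    have ha := (hP ζ hζ.1).analyticAt
    have h1 := (analyticAt_alphaCoeff (D := D) ha).differentiableAt
    have h2 := (analyticAt_betaCoeff (D := D) ha).differentiableAt
    have h3 : (2 : ℂ) * ζ ≠ 0 := mul_ne_zero two_ne_zero h0
    refine DifferentiableAt.differentiableWithinAt ?_
    refine (differentiableAt_id.pow 2).prodMk (differentiableAt_pi.2 fun k => ?_)
    refine DifferentiableAt.cexp ?_
    have h4 : DifferentiableAt ℂ (fun w : ℂ => Complex.I / (2 * w)) ζ :=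
      (differentiableAt_const _).div ((differentiableAt_const _).mul differentiableAt_id) h3
    simp only [exponent_eq]
    exact ((differentiableAt_const _).mul (h4.add (differentiableAt_id.mul h1))).add
      ((differentiableAt_const _).mul (((differentiableAt_const _).mul differentiableAt_id).mul h2))
  refine ⟨alphaCoeff D P, betaCoeff D P,
    ⟨S, Metric.isOpen_ball.sdiff isClosed_singleton, F, hdiff, hmaps⟩,
    analyticAt_alphaCoeff (hP 0 (Metric.mem_ball_self hr)).analyticAt,
    analyticAt_betaCoeff (hP 0 (Metric.mem_ball_self hr)).analyticAt,
    Filter.mem_of_superset hball fun ζ hζ => (hev ζ hζ).1,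
    Filter.mem_of_superset hball fun ζ hζ => (hev ζ hζ).2, ?_, ?_,
    ⟨r, hr, rfl, fun _ _ => rfl, ?_, ?_, ?_⟩, fun ζ hζ k => rfl⟩
  -- At `ζ = 0` the function `p` is `-i∂u`, so `⟨∂u p⟩ = -i⟨(∂u)²⟩`.
  · rw [alphaCoeff, hP0, map_smul, map_smul, smul_eq_mul, ← torusAverage_synth hγ.1]
    congr 2
    ext z
    rw [synth_torusMul, D.synth_du, sq]
  · rw [betaCoeff, zero_mul, sub_zero, ← torusAverage_synth hγ.1]
    congr 1
    exact funext D.synth_ch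
  · intro ζ hζ
    have h0 : ζ ≠ 0 := hζ.2
    have h1 : ‖ζ‖ < r := by simpa using hζ.1
    refine ⟨hmaps hζ, ?_, ?_⟩
    · exact norm_pos_iff.2 (pow_ne_zero 2 h0)
    · simp only [F, norm_pow]
      gcongr
  -- Equal `λ` leaves only `ζ' = ±ζ`, and the minus sign is excluded by the different multipliers.
  · intro ζ hζ ζ' hζ' heq
    have h1 : ζ ^ 2 = ζ' ^ 2 := congrArg Prod.fst heq
    rcases sq_eq_sq_iff_eq_or_eq_neg.1 h1 with h2 | h2
    · exact h2
    · exfalso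
      have h3 : ζ' = -ζ := by rw [h2, neg_neg]
      obtain ⟨k, hk⟩ := (hP ζ hζ.1).exists_multiplier_ne hu hγ (hP _ (hneg hζ.1)) hζ.2
      apply hk
      have h4 := congrFun (congrArg Prod.snd heq) k
      rw [h3] at h4
      exact h4
  · rintro ⟨lam, μ⟩ ⟨⟨hlam, ψ₁, ψ₂, hψ, hne, hμ⟩, hpos, hlt⟩
    simp only at hlam hψ hμ hpos hlt
    -- Either square root serves: the multipliers of the given solution decide between `ζ` and `-ζ`.
    obtain ⟨ζ, rfl⟩ := IsAlgClosed.exists_pow_nat_eq lam two_pos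
    have h0 : ζ ≠ 0 := by
      rintro rfl
      simp at hlam
    have hζr : ζ ∈ Metric.ball (0 : ℂ) r := by
      rw [norm_pow] at hlt
      simpa using lt_of_pow_lt_pow_left₀ 2 hr.le hlt
    have hg := hP ζ hζr
    have hg' := hP (-ζ) (hneg hζr)
    have e' := hg'.isEigenfunction hu hγ (neg_ne_zero.2 h0)
    rw [neg_sq] at e'
    rcases multiplier_eq_or_eq (c := γ) (ν := fun k => Complex.exp (exponent D P ζ k))
      (ρ := fun k => Complex.exp (exponent D P (-ζ) k)) hψ (hg.isEigenfunction hu hγ h0) e' hμ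
      (floquet_multiplier hγ.2) (floquet_multiplier hγ.2) (hg.wronskian_ne_zero hg' h0 0) hne
      with h | h
    · exact ⟨ζ, ⟨hζr, h0⟩, by rw [h]⟩
    · exact ⟨-ζ, ⟨hneg hζr, neg_ne_zero.2 h0⟩, by rw [h]; simp [F]⟩

end solution

/-! ### The reflection `z ↦ z̄`, `λ ↦ λ⁻¹` and the end over `λ = ∞` -/

section reflection
variable {u : ℂ → ℝ} {γ : Fin 2 → ℂ}

/-- The function `u` composed with complex conjugation. -/
def reflect (u : ℂ → ℝ) (z : ℂ) : ℝ := u (conj z)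

/-- The complex conjugates of the periods. -/
noncomputable def conjPeriods (γ : Fin 2 → ℂ) (k : Fin 2) : ℂ := conj (γ k)

theorem reflect_reflect (u : ℂ → ℝ) : reflect (reflect u) = u := by
  ext z; simp [reflect]

theorem conjPeriods_conjPeriods (γ : Fin 2 → ℂ) : conjPeriods (conjPeriods γ) = γ := by
  ext k; simp [conjPeriods]

theorem hasW_cplx_reflect (hu : ContDiff ℝ ∞ u) (z : ℂ) :
    HasW (cplx (reflect u)) (delbar (cplx u) (conj z)) (del (cplx u) (conj z)) z :=
  (hasW_cplx hu (conj z)).comp_conj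

theorem contDiff_reflect (hu : ContDiff ℝ ∞ u) : ContDiff ℝ ∞ (reflect u) :=
  hu.comp (Complex.conjCLE : ℂ →L[ℝ] ℂ).contDiff

theorem isSolution_reflect (hu : IsSolution u) : IsSolution (reflect u) := by
  refine ⟨contDiff_reflect hu.1, fun z => ?_⟩
  have h1 : delbar (cplx (reflect u)) = fun w => del (cplx u) (conj w) :=
    funext fun w => (hasW_cplx_reflect hu.1 w).delbar_eq
  rw [h1, (HasW.comp_conj (hasW_del_cplx hu (conj z))).del_eq, reflect]
  ring

theorem isDoublyPeriodic_reflect (hγ : IsDoublyPeriodic u γ) :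
    IsDoublyPeriodic (reflect u) (conjPeriods γ) := by
  refine ⟨?_, fun k z => by simp [reflect, conjPeriods, hγ.2]⟩
  have := hγ.1.map' (Complex.conjCLE : ℂ →ₗ[ℝ] ℂ)
    (LinearMap.ker_eq_bot.2 Complex.conjCLE.injective)
  exact this

/-- Conjugating `z` exchanges `∂` with `∂̄`, and swapping the components carries the `∂̄`-matrix at
`λ` to the `∂`-matrix at `λ⁻¹`. -/
theorem isEigenfunction_reflect (hu : ContDiff ℝ ∞ u) {lam : ℂ} {ψ₁ ψ₂ : ℂ → ℂ}
    (h : IsEigenfunction u lam ψ₁ ψ₂) :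
    IsEigenfunction (reflect u) lam⁻¹ (fun z => ψ₂ (conj z)) (fun z => ψ₁ (conj z)) := by
  have h1 := fun z => ((hasW_of_differentiableAt (h.differentiable_fst (conj z))).congr_deriv
    (h.del_fst _) (h.delbar_fst _)).comp_conj
  have h2 := fun z => ((hasW_of_differentiableAt (h.differentiable_snd (conj z))).congr_deriv
    (h.del_snd _) (h.delbar_snd _)).comp_conj
  refine ⟨fun z => (h2 z).differentiableAt, fun z => (h1 z).differentiableAt, fun z => ?_,
    fun z => ?_, fun z => ?_, fun z => ?_⟩
  · rw [(h2 z).del_eq, (hasW_cplx_reflect hu z).del_eq, reflect]; ring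
  · rw [(h1 z).del_eq, (hasW_cplx_reflect hu z).del_eq, reflect, inv_inv]; ring
  · rw [(h2 z).delbar_eq, (hasW_cplx_reflect hu z).delbar_eq, reflect]; ring
  · rw [(h1 z).delbar_eq, (hasW_cplx_reflect hu z).delbar_eq, reflect]; ring

theorem mem_spectralCurve_reflect (hu : ContDiff ℝ ∞ u) {p : ℂ × (Fin 2 → ℂ)}
    (hp : p ∈ spectralCurve u γ) :
    (p.1⁻¹, p.2) ∈ spectralCurve (reflect u) (conjPeriods γ) := by
  obtain ⟨h0, ψ₁, ψ₂, hψ, ⟨z, hz⟩, hμ⟩ := hp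
  refine ⟨inv_ne_zero h0, _, _, isEigenfunction_reflect hu hψ, ⟨conj z, ?_⟩, fun k w => ?_⟩
  · simpa [or_comm] using hz
  · have := hμ k (conj w)
    simpa [conjPeriods, and_comm] using this

theorem torusAverage_reflect (hγ : LinearIndependent ℝ γ)
    (hγ' : LinearIndependent ℝ (conjPeriods γ)) (g : ℂ → ℂ) :
    torusAverage (conjPeriods γ) (fun z => g (conj z)) = torusAverage γ g := by
  rw [torusAverage_eq hγ, torusAverage_eq hγ']
  congr 1
  ext z
  simp [periodMap_apply, conjPeriods]

/-- The part of the spectral curve over a punctured disc around `lam = ∞`. -/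
theorem exists_arc_at_infty (hu : IsSolution u) (hγ : IsDoublyPeriodic u γ) :
    ∃ (α β : ℂ → ℂ) (c : Arc (spectralCurve u γ)), AnalyticAt ℂ α 0 ∧ AnalyticAt ℂ β 0 ∧
      (∀ᶠ ζ in 𝓝 0, α (-ζ) = α ζ) ∧ (∀ᶠ ζ in 𝓝 0, β (-ζ) = β ζ) ∧
      α 0 = -Complex.I * torusAverage γ (fun z => delbar (cplx u) z ^ 2) ∧
      β 0 = torusAverage γ (fun z => (Real.cosh (2 * u z) : ℂ)) ∧
      IsRootParamAtInfty c ∧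
      ∀ ζ ∈ c.domain, ∀ k, (c.toFun ζ).2 k = Complex.exp
        (conj (γ k) * (Complex.I / (2 * ζ) + ζ * α ζ) + γ k * (Complex.I / 2 * ζ * β ζ)) := by
  have hγ' := isDoublyPeriodic_reflect hγ
  obtain ⟨α, β, c, hα, hβ, hαe, hβe, hα0, hβ0, ⟨r, hr, hdom, hfst, hbij⟩, hmult⟩ :=
    exists_arc_at_zero (isSolution_reflect hu) hγ'
  have hback : ∀ {p}, p ∈ spectralCurve (reflect u) (conjPeriods γ) →
      (p.1⁻¹, p.2) ∈ spectralCurve u γ := fun {p} hp => by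
    have := mem_spectralCurve_reflect (contDiff_reflect hu.1) hp
    rwa [reflect_reflect, conjPeriods_conjPeriods] at this
  refine ⟨α, β, ⟨c.domain, c.isOpen_domain, fun ξ => ((c.toFun ξ).1⁻¹, (c.toFun ξ).2), ?_, ?_⟩,
    hα, hβ, hαe, hβe, ?_, ?_, ⟨r, hr, hdom, ?_, ?_, ?_, ?_⟩, ?_⟩
  · exact (c.holomorphic.fst.inv fun ξ hξ => (c.mapsTo hξ).1).prodMk c.holomorphic.snd
  · exact fun ξ hξ => hback (c.mapsTo hξ)
  · rw [hα0, ← torusAverage_reflect hγ.1 hγ'.1]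
    congr 2
    ext z
    rw [(hasW_cplx_reflect hu.1 z).del_eq]
  · rw [hβ0, ← torusAverage_reflect hγ.1 hγ'.1]
    rfl
  · intro ξ hξ
    simp only [hfst ξ hξ]
  · intro ξ hξ
    obtain ⟨h1, h2, h3⟩ := hbij.mapsTo hξ
    refine ⟨hback h1, ?_⟩
    simp only [norm_inv]
    exact inv_strictAnti₀ h2 h3
  · intro ξ hξ ξ' hξ' h
    apply hbij.injOn hξ hξ'
    simp only [Prod.mk.injEq, inv_inj] at h
    exact Prod.ext h.1 h.2
  · rintro ⟨lam, μ⟩ ⟨hmem, hlt⟩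
    have h0 : lam ≠ 0 := hmem.1
    have h1 := mem_spectralCurve_reflect hu.1 hmem
    have h2 : ((lam⁻¹, μ) : ℂ × (Fin 2 → ℂ)) ∈ {p | p ∈ spectralCurve (reflect u) (conjPeriods γ) ∧
        0 < ‖p.1‖ ∧ ‖p.1‖ < r ^ 2} := by
      refine ⟨h1, norm_pos_iff.2 (inv_ne_zero h0), ?_⟩
      simp only [norm_inv]
      exact inv_lt_of_inv_lt₀ (by positivity) hlt
    obtain ⟨ξ, hξ, hξe⟩ := hbij.surjOn h2
    exact ⟨ξ, hξ, by simp [hξe]⟩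
  · intro ξ hξ k
    have := hmult ξ hξ k
    simpa [conjPeriods] using this

end reflection

/-! ### Expansions of even functions -/

/-- Taylor expansion of an even holomorphic function. -/
theorem exists_even_expansion {g : ℂ → ℂ} (hg : AnalyticAt ℂ g 0)
    (he : ∀ᶠ ζ in 𝓝 0, g (-ζ) = g ζ) :
    ∃ h : ℂ → ℂ, AnalyticAt ℂ h 0 ∧ ∀ᶠ ζ in 𝓝 0, g ζ = g 0 + ζ ^ 2 * h ζ := by
  have hd : deriv g 0 = 0 := by
    have h1 : deriv (fun ζ => g (-ζ)) 0 = deriv g 0 := Filter.EventuallyEq.deriv_eq he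
    rw [deriv_comp_neg, neg_zero] at h1
    have h2 : (2 : ℂ) * deriv g 0 = 0 := by linear_combination -h1
    exact (mul_eq_zero.1 h2).resolve_left two_ne_zero
  have hf : AnalyticAt ℂ (fun ζ => g ζ - g 0) 0 := hg.sub analyticAt_const
  have ho : ((2 : ℕ) : ℕ∞) ≤ analyticOrderAt (fun ζ => g ζ - g 0) 0 := by
    rw [natCast_le_analyticOrderAt_iff_iteratedDeriv_eq_zero hf]
    intro i hi
    interval_cases i
    · simp
    · simp [iteratedDeriv_one, hd]
  obtain ⟨h, hh, hev⟩ := (natCast_le_analyticOrderAt hf).1 ho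
  refine ⟨h, hh, ?_⟩
  filter_upwards [hev] with ζ hζ
  simp only [sub_zero, smul_eq_mul] at hζ
  linear_combination hζ

/-- Writing `g = g(0) + ζ² h`, the derivative of `ζ g` is `g(0) + ζ²(3h + ζh')`. -/
theorem deriv_mul_even_isBigO {g : ℂ → ℂ} (hg : AnalyticAt ℂ g 0)
    (he : ∀ᶠ ζ in 𝓝 0, g (-ζ) = g ζ) :
    (fun ζ => deriv (fun w => w * g w) ζ - g 0) =O[𝓝[≠] 0] fun ζ : ℂ => ζ ^ 2 := by
  obtain ⟨h, hh, hev⟩ := exists_even_expansion hg he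
  have hB : (fun ζ => 3 * h ζ + ζ * deriv h ζ) =O[𝓝 0] (fun _ => (1 : ℂ)) := by
    have h1 := hh.continuousAt
    have h2 := hh.deriv.continuousAt
    have : ContinuousAt (fun ζ => 3 * h ζ + ζ * deriv h ζ) 0 := by fun_prop
    exact this.tendsto.isBigO_one ℂ
  have key : (fun ζ => deriv (fun w => w * g w) ζ - g 0) =ᶠ[𝓝 0]
      fun ζ => ζ ^ 2 * (3 * h ζ + ζ * deriv h ζ) := by
    filter_upwards [hev.eventually_nhds, hh.eventually_analyticAt] with ζ h1 h2
    have h3 : (fun w => w * g w) =ᶠ[𝓝 ζ] fun w => g 0 * w + w ^ 3 * h w := by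
      filter_upwards [h1] with w hw
      rw [hw]; ring
    have h4 : HasDerivAt (fun w => g 0 * w + w ^ 3 * h w)
        (g 0 * 1 + (((3 : ℕ) : ℂ) * ζ ^ 2 * h ζ + ζ ^ 3 * deriv h ζ)) ζ := by
      have := ((hasDerivAt_id ζ).const_mul (g 0)).add
        ((hasDerivAt_pow 3 ζ).mul h2.differentiableAt.hasDerivAt)
      exact this
    rw [h3.deriv_eq, h4.deriv]
    push_cast
    ring
  have h5 : (fun ζ => ζ ^ 2 * (3 * h ζ + ζ * deriv h ζ)) =O[𝓝 0] fun ζ : ℂ => ζ ^ 2 * 1 :=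
    (isBigO_refl _ _).mul hB
  simp only [mul_one] at h5
  exact (h5.congr' key.symm Filter.EventuallyEq.rfl).mono nhdsWithin_le_nhds

/-! ### The differentials `dp⁺`, `dp⁻` and their expansions -/

/-- A linear combination of two differentials. -/
def SinhGordon.Differential.comb {S : Set (ℂ × (Fin 2 → ℂ))} (a b : ℂ) (θ η : Differential S) :
    Differential S where
  coeff c ζ := a * θ.coeff c ζ + b * η.coeff c ζ
  holomorphic c := ((θ.holomorphic c).const_mul a).add ((η.holomorphic c).const_mul b)
  pullback c d φ hφ hm hd ζ hζ := by
    rw [θ.pullback c d φ hφ hm hd ζ hζ, η.pullback c d φ hφ hm hd ζ hζ]; ring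

/-- The differential `dp⁺`, from the relation `d ln μ_k = γ_k dp⁺ + γ̄_k dp⁻` by Cramer's rule. -/
noncomputable def dpPlus (u : ℂ → ℝ) (γ : Fin 2 → ℂ) : Differential (spectralCurve u γ) :=
  Differential.comb (conj (γ 1) / periodDet γ) (-conj (γ 0) / periodDet γ)
    (dlnMu u γ 0) (dlnMu u γ 1)

/-- The differential `dp⁻`, from the relation `d ln μ_k = γ_k dp⁺ + γ̄_k dp⁻` by Cramer's rule. -/
noncomputable def dpMinus (u : ℂ → ℝ) (γ : Fin 2 → ℂ) : Differential (spectralCurve u γ) :=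
  Differential.comb (-γ 1 / periodDet γ) (γ 0 / periodDet γ) (dlnMu u γ 0) (dlnMu u γ 1)

section solution
variable {u : ℂ → ℝ} {γ : Fin 2 → ℂ}

theorem isDpPair_dp (hγ : LinearIndependent ℝ γ) : IsDpPair u γ (dpPlus u γ) (dpMinus u γ) := by
  have hd := periodDet_ne_zero hγ
  intro k c ζ _
  simp only [dpPlus, dpMinus, Differential.comb]
  field_simp
  fin_cases k
  · simp only [periodDet, Fin.zero_eta, Fin.isValue]; ring
  · simp only [periodDet, Fin.mk_one, Fin.isValue]; ring

/-- Cramer's rule at a single point of an arc; it serves both for uniqueness and for reading off the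
coefficients from the explicit multipliers. -/
theorem dp_coeff_eq (hγ : LinearIndependent ℝ γ) (c : Arc (spectralCurve u γ)) {ζ a b : ℂ}
    (h : ∀ k, (dlnMu u γ k).coeff c ζ = γ k * a + conj (γ k) * b) :
    (dpPlus u γ).coeff c ζ = a ∧ (dpMinus u γ).coeff c ζ = b := by
  have hd := periodDet_ne_zero hγ
  simp only [dpPlus, dpMinus, Differential.comb, h]
  constructor
  · field_simp
    simp only [periodDet]; ring
  · field_simp
    simp only [periodDet]; ring

/-- The parameters `A`, `B` stand for `γ_k` and its conjugate, in this order at `λ = 0` and in the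
reverse order at `λ = ∞`. -/
theorem dlnMu_coeff_of_exp {c : Arc (spectralCurve u γ)} {k : Fin 2} {ζ A B : ℂ} {α β : ℂ → ℂ}
    (hζ : ζ ∈ c.domain) (h0 : ζ ≠ 0) (hα : AnalyticAt ℂ α ζ) (hβ : AnalyticAt ℂ β ζ)
    (h : ∀ w ∈ c.domain, (c.toFun w).2 k = Complex.exp
      (A * (Complex.I / (2 * w) + w * α w) + B * (Complex.I / 2 * w * β w))) :
    (dlnMu u γ k).coeff c ζ =
      A * (-(Complex.I / 2) * (ζ ^ 2)⁻¹ + deriv (fun w => w * α w) ζ) +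
        B * (Complex.I / 2 * deriv (fun w => w * β w) ζ) := by
  have h1 : (fun w => (c.toFun w).2 k) =ᶠ[𝓝 ζ] fun w => Complex.exp
      (A * (Complex.I / 2 * w⁻¹ + w * α w) + B * (Complex.I / 2 * (w * β w))) := by
    filter_upwards [c.isOpen_domain.mem_nhds hζ] with w hw
    rw [h w hw]
    congr 1
    ring
  have ha : HasDerivAt (fun w => w * α w) (deriv (fun w => w * α w) ζ) ζ :=
    (differentiableAt_id.mul hα.differentiableAt).hasDerivAt
  have hb : HasDerivAt (fun w => w * β w) (deriv (fun w => w * β w) ζ) ζ :=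
    (differentiableAt_id.mul hβ.differentiableAt).hasDerivAt
  have h2 := (((((hasDerivAt_inv h0).const_mul (Complex.I / 2)).add ha).const_mul A).add
    ((hb.const_mul (Complex.I / 2)).const_mul B)).cexp
  have h3 : (c.toFun ζ).2 k = _ := h1.self_of_nhds
  simp only [dlnMu]
  rw [h1.deriv_eq, h3]
  refine (congrArg (· / _) h2.deriv).trans ?_
  simp only [Pi.add_apply]
  rw [mul_div_cancel_left₀ _ (Complex.exp_ne_zero _)]
  ring

theorem mem_nhdsNE_of_eq_ball_diff {s : Set ℂ} {r : ℝ} (hr : 0 < r)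
    (hs : s = Metric.ball (0 : ℂ) r \ {0}) : s ∈ 𝓝[≠] (0 : ℂ) := by
  rw [hs]
  exact sdiff_mem_nhdsWithin_compl (Metric.ball_mem_nhds 0 hr) _

/-- Expansions of `x = -(i/2) ζ⁻² + (ζ α)'` and `y = (i/2) (ζ β)'` for even `α` and `β`. -/
theorem expansions_of_even {α β x y : ℂ → ℂ} {a b : ℂ} (hα : AnalyticAt ℂ α 0)
    (hβ : AnalyticAt ℂ β 0) (hαe : ∀ᶠ ζ in 𝓝 0, α (-ζ) = α ζ)
    (hβe : ∀ᶠ ζ in 𝓝 0, β (-ζ) = β ζ) (hα0 : α 0 = -Complex.I * a) (hβ0 : β 0 = b)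
    (hx : ∀ᶠ ζ in 𝓝[≠] 0, x ζ = -(Complex.I / 2) * (ζ ^ 2)⁻¹ + deriv (fun w => w * α w) ζ)
    (hy : ∀ᶠ ζ in 𝓝[≠] 0, y ζ = Complex.I / 2 * deriv (fun w => w * β w) ζ) :
    ExtendsHolomorphically y ∧
      (fun ζ => x ζ - (-(Complex.I / 2) * (ζ ^ 2)⁻¹ - Complex.I * a))
        =O[𝓝[≠] 0] (fun ζ : ℂ => ζ ^ 2) ∧
      (fun ζ => y ζ - Complex.I / 2 * b) =O[𝓝[≠] 0] (fun ζ : ℂ => ζ ^ 2) := by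
  refine ⟨⟨fun ζ => Complex.I / 2 * deriv (fun w => w * β w) ζ,
    analyticAt_const.mul (analyticAt_id.mul hβ).deriv, hy⟩, ?_, ?_⟩
  · refine (deriv_mul_even_isBigO hα hαe).congr' ?_ Filter.EventuallyEq.rfl
    filter_upwards [hx] with ζ hζ
    rw [hζ, hα0]; ring
  · refine ((deriv_mul_even_isBigO hβ hβe).const_mul_left (Complex.I / 2)).congr' ?_
      Filter.EventuallyEq.rfl
    filter_upwards [hy] with ζ hζ
    rw [hζ, hβ0]; ring

end solution

theorem mainTheorem8 (u : ℂ → ℝ) (γ : Fin 2 → ℂ)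
    (hu : IsSolution u) (hγ : IsDoublyPeriodic u γ) :
    ∃ dpPlus dpMinus : Differential (spectralCurve u γ),
      -- the relation defining `dp⁺, dp⁻`, which determines them
      IsDpPair u γ dpPlus dpMinus ∧
      (∀ θ η : Differential (spectralCurve u γ), IsDpPair u γ θ η →
        θ.Agree dpPlus ∧ η.Agree dpMinus) ∧
      -- expansions at `lam = 0`, with `ζ = lam ^ (1/2)`
      (∃ c : Arc (spectralCurve u γ), IsRootParamAtZero c ∧
        ExtendsHolomorphically (dpMinus.coeff c) ∧
        (fun ζ => dpPlus.coeff c ζ - (-(Complex.I / 2) * (ζ ^ 2)⁻¹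
            - Complex.I * torusAverage γ (fun z => del (cplx u) z ^ 2)))
          =O[𝓝[≠] 0] (fun ζ : ℂ => ζ ^ 2) ∧
        (fun ζ => dpMinus.coeff c ζ -
            Complex.I / 2 * torusAverage γ (fun z => (Real.cosh (2 * u z) : ℂ)))
          =O[𝓝[≠] 0] (fun ζ : ℂ => ζ ^ 2)) ∧
      -- expansions at `lam = ∞`, with `ξ = lam ^ (-1/2)`
      (∃ c : Arc (spectralCurve u γ), IsRootParamAtInfty c ∧
        ExtendsHolomorphically (dpPlus.coeff c) ∧
        (fun ξ => dpPlus.coeff c ξ -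
            Complex.I / 2 * torusAverage γ (fun z => (Real.cosh (2 * u z) : ℂ)))
          =O[𝓝[≠] 0] (fun ξ : ℂ => ξ ^ 2) ∧
        (fun ξ => dpMinus.coeff c ξ - (-(Complex.I / 2) * (ξ ^ 2)⁻¹
            - Complex.I * torusAverage γ (fun z => delbar (cplx u) z ^ 2)))
          =O[𝓝[≠] 0] (fun ξ : ℂ => ξ ^ 2)) := by
  have huniq : ∀ θ η : Differential (spectralCurve u γ), IsDpPair u γ θ η →
      θ.Agree (dpPlus u γ) ∧ η.Agree (dpMinus u γ) := fun θ η h =>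
    ⟨fun c ζ hζ => ((dp_coeff_eq hγ.1 c fun k => h k c ζ hζ).1).symm,
      fun c ζ hζ => ((dp_coeff_eq hγ.1 c fun k => h k c ζ hζ).2).symm⟩
  refine ⟨dpPlus u γ, dpMinus u γ, isDpPair_dp hγ.1, huniq, ?_, ?_⟩
  · obtain ⟨α, β, c, hα, hβ, hαe, hβe, hα0, hβ0, hc, hmult⟩ := exists_arc_at_zero hu hγ
    obtain ⟨r, hr, hdom, -⟩ := id hc
    have hev : ∀ᶠ ζ in 𝓝[≠] (0 : ℂ),
        (dpPlus u γ).coeff c ζ = -(Complex.I / 2) * (ζ ^ 2)⁻¹ + deriv (fun w => w * α w) ζ ∧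
        (dpMinus u γ).coeff c ζ = Complex.I / 2 * deriv (fun w => w * β w) ζ := by
      filter_upwards [mem_nhdsNE_of_eq_ball_diff hr hdom, self_mem_nhdsWithin,
        hα.eventually_analyticAt.filter_mono nhdsWithin_le_nhds,
        hβ.eventually_analyticAt.filter_mono nhdsWithin_le_nhds] with ζ h1 h2 h3 h4
      exact dp_coeff_eq hγ.1 c fun k =>
        dlnMu_coeff_of_exp h1 h2 h3 h4 fun w hw => hmult w hw k
    exact ⟨c, hc, expansions_of_even hα hβ hαe hβe hα0 hβ0 (hev.mono fun _ h => h.1)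
      (hev.mono fun _ h => h.2)⟩
  · obtain ⟨α, β, c, hα, hβ, hαe, hβe, hα0, hβ0, hc, hmult⟩ := exists_arc_at_infty hu hγ
    obtain ⟨r, hr, hdom, -⟩ := id hc
    have hev : ∀ᶠ ζ in 𝓝[≠] (0 : ℂ),
        (dpPlus u γ).coeff c ζ = Complex.I / 2 * deriv (fun w => w * β w) ζ ∧
        (dpMinus u γ).coeff c ζ = -(Complex.I / 2) * (ζ ^ 2)⁻¹ + deriv (fun w => w * α w) ζ := by
      filter_upwards [mem_nhdsNE_of_eq_ball_diff hr hdom, self_mem_nhdsWithin,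
        hα.eventually_analyticAt.filter_mono nhdsWithin_le_nhds,
        hβ.eventually_analyticAt.filter_mono nhdsWithin_le_nhds] with ζ h1 h2 h3 h4
      -- Here the pole is attached to `γ̄_k`, so `dp⁺` and `dp⁻` exchange their roles.
      refine dp_coeff_eq hγ.1 c fun k => ?_
      rw [dlnMu_coeff_of_exp h1 h2 h3 h4 fun w hw => hmult w hw k]
      ring
    obtain ⟨h1, h2, h3⟩ := expansions_of_even hα hβ hαe hβe hα0 hβ0 (hev.mono fun _ h => h.2)
      (hev.mono fun _ h => h.1)
    exact ⟨c, hc, h1, h3, h2⟩
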